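/- Let $k$ be a field of characteristic other than $2$. A *2-vector space* is a category internal to $k$-vector spaces: vector spaces $L_0$ (objects) and $L_1$ (morphisms) with linear source, target, identity and composition maps satisfying the category axioms; composites are written in diagrammatic order. The *arrow part* of $f\colon x\to y$ is $f-1_x$. A *Lie 2-algebra* (semistrict) is a 2-vector space $L$ with a skew-symmetric functor $[\cdot,\cdot]\colon L\times L\to L$, bilinear on objects and on morphisms, and a trilinear natural isomorphism $J_{x,y,z}\colon [[x,y],z]\to[x,[y,z]]+[[x,z],y]$ (the Jacobiator) whose arrow part is completely antisymmetric in $x,y,z$, such that for all objects $w,x,y,z$ $$J_{[w,x],y,z}\,\bigl([J_{w,x,z},y]+1\bigr)\,\bigl(J_{w,[x,z],y}+J_{[w,z],x,y}+J_{w,x,[y,z]}\bigr)=[J_{w,x,y},z]\,\bigl(J_{[w,y],x,z}+J_{w,[x,y],z}\bigr)\,\bigl([J_{w,y,z},x]+1\bigr)\,\bigl([w,J_{x,y,z}]+1\bigr),$$ where each $1$ is the identity morphism that makes the composite defined. A *homomorphism* $F\colon L\to L'$ is a linear functor $(F_0,F_1)$ with a skew-symmetric bilinear natural transformation $F_2(x,y)\colon[F_0x,F_0y]\to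 F_0[x,y]$ such that $$[F_2(x,y),F_0z]\;F_2([x,y],z)\;F_1(J_{x,y,z})=J_{F_0x,F_0y,F_0z}\;\bigl([F_0x,F_2(y,z)]+[F_2(x,z),F_0y]\bigr)\;\bigl(F_2(x,[y,z])+F_2([x,z],y)\bigr).$$ A *2-homomorphism* $\theta\colon F\Rightarrow G$ is a linear natural transformation with $F_2(x,y)\,\theta_{[x,y]}=[\theta_x,\theta_y]\,G_2(x,y)$. Composition of homomorphisms is composition of functors with $(FG)_2(x,y)=G_2(F_0x,F_0y)\;G_1(F_2(x,y))$, where $FG$ is $F$ followed by $G$; the identity homomorphism is the identity functor with identity transformation; 2-homomorphisms are composed as natural transformations. These form a 2-category $\mathrm{Lie2Alg}$. Lie 2-algebras $L,L'$ are *equivalent* if there are homomorphisms $F\colon L\to L'$, $G\colon L'\to L$ and invertible 2-homomorphisms $FG\Rightarrow 1_L$ and $GF\Rightarrow 1_{L'}$. Consider quadruples $(\mathfrak g,V,\rho,c)$ with $\mathfrak g$ a Lie algebra over $k$, $V$ a vector space over $k$, $\rho$ a representation of $\mathfrak g$ on $V$, and $c\in H^3(\mathfrak g,V)$ a Lie algebra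 (Chevalley–Eilenberg) cohomology class. An isomorphism $(\mathfrak g,V,\rho,c)\to(\mathfrak g',V',\rho',c')$ is a Lie algebra isomorphism $\varphi\colon\mathfrak g\to\mathfrak g'$ together with a linear isomorphism $\psi\colon V\to V'$ such that $\psi(\rho(x)v)=\rho'(\varphi(x))\psi(v)$ and the induced map $H^3(\mathfrak g,V)\to H^3(\mathfrak g',V')$ sends $c$ to $c'$. **Theorem.** There is a one-to-one correspondence between equivalence classes of Lie 2-algebras over $k$ and isomorphism classes of quadruples $(\mathfrak g,V,\rho,c)$. Under it, for every Lie algebra $\mathfrak g$, representation $\rho$ of $\mathfrak g$ on $V$ and 3-cocycle $\omega$ on $\mathfrak g$ with values in $V$, the class of $(\mathfrak g,V,\rho,[\omega])$ corresponds to the class of the skeletal Lie 2-algebra with objects $\mathfrak g$, morphisms $(x,v)\colon x\to x$ for $(x,v)\in\mathfrak g\oplus V$, composition $(x,v)(x,v')=(x,v+v')$, bracket $[x,y]$ of $\mathfrak g$ on objects and $[(x,v),(y,w)]=([x,y],\rho(x)w-\rho(y)v)$ on morphisms, and Jacobiator $J_{x,y,z}=([[x,y],z],\omega(x,y,z))$.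 -/

import Mathlib

universe u v

set_option maxSynthPendingDepth 6

/-! ### Two-vector spaces: categories internal to vector spaces -/

/-- A 2-vector space over `k`: a category in the category of `k`-vector spaces.  Composition is
written in diagrammatic order: `comp ⟨(f, g), _⟩` is `f` followed by `g`. -/
structure TwoVectorSpace (k : Type u) [Field k] where
  /-- the vector space of objects -/
  Ob : Type v
  /-- the vector space of morphisms -/
  Mor : Type v
  [obAddCommGroup : AddCommGroup Ob]
  [obModule : Module k Ob]
  [morAddCommGroup : AddCommGroup Mor]
  [morModule : Module k Mor]
  /-- source -/
  s : Mor →ₗ[k] Ob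
  /-- target -/
  t : Mor →ₗ[k] Ob
  /-- identity-assigning map -/
  i : Ob →ₗ[k] Mor
  /-- composition, a linear map on the pullback of composable pairs -/
  comp : LinearMap.eqLocus (t ∘ₗ LinearMap.fst k Mor Mor) (s ∘ₗ LinearMap.snd k Mor Mor) →ₗ[k] Mor
  s_i : ∀ x, s (i x) = x
  t_i : ∀ x, t (i x) = x
  s_comp : ∀ (f g : Mor) (h : t f = s g), s (comp ⟨(f, g), h⟩) = s f
  t_comp : ∀ (f g : Mor) (h : t f = s g), t (comp ⟨(f, g), h⟩) = t g
  id_comp : ∀ f : Mor, comp ⟨(i (s f), f), t_i (s f)⟩ = f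
  comp_id : ∀ f : Mor, comp ⟨(f, i (t f)), (s_i (t f)).symm⟩ = f
  assoc : ∀ (f g h : Mor) (hfg : t f = s g) (hgh : t g = s h),
    comp ⟨(comp ⟨(f, g), hfg⟩, h), (t_comp f g hfg).trans hgh⟩ =
      comp ⟨(f, comp ⟨(g, h), hgh⟩), hfg.trans (s_comp g h hgh).symm⟩

attribute [instance] TwoVectorSpace.obAddCommGroup TwoVectorSpace.obModule
  TwoVectorSpace.morAddCommGroup TwoVectorSpace.morModule

namespace TwoVectorSpace

variable {k : Type u} [Field k]

/-- The composite `f g` of `f : x → y` and `g : y → z`. -/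
def compose (V : TwoVectorSpace.{u, v} k) (f g : V.Mor) (h : V.t f = V.s g) : V.Mor :=
  V.comp ⟨(f, g), h⟩

/-- The arrow part `f - 1_{s(f)}` of a morphism. -/
def arrow (V : TwoVectorSpace.{u, v} k) (f : V.Mor) : V.Mor := f - V.i (V.s f)

/-- `f` is an isomorphism. -/
def IsIso (V : TwoVectorSpace.{u, v} k) (f : V.Mor) : Prop :=
  ∃ (g : V.Mor) (h : V.t f = V.s g) (h' : V.t g = V.s f),
    V.compose f g h = V.i (V.s f) ∧ V.compose g f h' = V.i (V.t f)

theorem compose_eq (V : TwoVectorSpace.{u, v} k) (f g : V.Mor) (h : V.t f = V.s g) :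
    V.compose f g h = f + g - V.i (V.t f) := by
  have hs : V.s (g - V.i (V.t f)) = 0 := by simp [V.s_i, h]
  have h2 : V.comp ⟨(V.i (V.s (g - V.i (V.t f))), g - V.i (V.t f)), V.t_i _⟩ =
      g - V.i (V.t f) := V.id_comp _
  have h3 := V.comp_id f
  have e : (⟨(f, g), h⟩ : LinearMap.eqLocus (V.t ∘ₗ LinearMap.fst k V.Mor V.Mor)
      (V.s ∘ₗ LinearMap.snd k V.Mor V.Mor)) =
      ⟨(f, V.i (V.t f)), (V.s_i (V.t f)).symm⟩ +
      ⟨(V.i (V.s (g - V.i (V.t f))), g - V.i (V.t f)), V.t_i _⟩ := by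
    apply Subtype.ext
    simp [hs]
  unfold compose
  rw [e, map_add, h2, h3]
  abel

@[simp] theorem s_compose (V : TwoVectorSpace.{u, v} k) (f g : V.Mor) (h : V.t f = V.s g) :
    V.s (V.compose f g h) = V.s f := V.s_comp f g h

@[simp] theorem t_compose (V : TwoVectorSpace.{u, v} k) (f g : V.Mor) (h : V.t f = V.s g) :
    V.t (V.compose f g h) = V.t g := V.t_comp f g h

attribute [simp] s_i t_i

theorem isIso (V : TwoVectorSpace.{u, v} k) (f : V.Mor) : V.IsIso f := by
  refine ⟨V.i (V.s f) + V.i (V.t f) - f, by simp, by simp, ?_, ?_⟩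
  · rw [compose_eq]; abel
  · rw [compose_eq]; simp

end TwoVectorSpace

/-- A linear functor between 2-vector spaces: a functor in the category of vector spaces. -/
structure LinearFunctor {k : Type u} [Field k] (V W : TwoVectorSpace.{u, v} k) where
  obj : V.Ob →ₗ[k] W.Ob
  mor : V.Mor →ₗ[k] W.Mor
  s_mor : ∀ f, W.s (mor f) = obj (V.s f)
  t_mor : ∀ f, W.t (mor f) = obj (V.t f)
  mor_i : ∀ x, mor (V.i x) = W.i (obj x)
  mor_comp : ∀ (f g : V.Mor) (h : V.t f = V.s g),
    mor (V.compose f g h) =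
      W.compose (mor f) (mor g) ((t_mor f).trans ((congrArg obj h).trans (s_mor g).symm))

/-- A bilinear functor `V × V' → W`: a functor that is bilinear on objects and on morphisms. -/
structure BilinearFunctor {k : Type u} [Field k] (V V' W : TwoVectorSpace.{u, v} k) where
  obj : V.Ob →ₗ[k] V'.Ob →ₗ[k] W.Ob
  mor : V.Mor →ₗ[k] V'.Mor →ₗ[k] W.Mor
  s_mor : ∀ f g, W.s (mor f g) = obj (V.s f) (V'.s g)
  t_mor : ∀ f g, W.t (mor f g) = obj (V.t f) (V'.t g)
  mor_i : ∀ x y, mor (V.i x) (V'.i y) = W.i (obj x y)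
  mor_comp : ∀ (f f' : V.Mor) (g g' : V'.Mor) (hf : V.t f = V.s f') (hg : V'.t g = V'.s g'),
    mor (V.compose f f' hf) (V'.compose g g' hg) =
      W.compose (mor f g) (mor f' g') (by rw [t_mor, s_mor, hf, hg])

/-- `F(x, y) = -F(y, x)` on objects and on morphisms. -/
structure BilinearFunctor.IsSkew {k : Type u} [Field k] {V W : TwoVectorSpace.{u, v} k}
    (F : BilinearFunctor V V W) : Prop where
  obj : ∀ x y, F.obj x y = -F.obj y x
  mor : ∀ f g, F.mor f g = -F.mor g f

/-! ### Semistrict Lie 2-algebras -/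

/-- The data of a semistrict Lie 2-algebra, before the Jacobiator identity is imposed:
a 2-vector space with a skew-symmetric bilinear bracket functor and a completely antisymmetric
trilinear natural isomorphism `J x y z : [[x,y],z] → [x,[y,z]] + [[x,z],y]`. -/
structure PreLieTwoAlgebra (k : Type u) [Field k] extends TwoVectorSpace.{u, v} k where
  bracket : BilinearFunctor toTwoVectorSpace toTwoVectorSpace toTwoVectorSpace
  bracket_skew : bracket.IsSkew
  /-- the Jacobiator -/
  J : Ob →ₗ[k] Ob →ₗ[k] Ob →ₗ[k] Mor
  s_J : ∀ x y z, s (J x y z) = bracket.obj (bracket.obj x y) z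
  t_J : ∀ x y z, t (J x y z) =
    bracket.obj x (bracket.obj y z) + bracket.obj (bracket.obj x z) y
  J_natural : ∀ f g h : Mor,
    toTwoVectorSpace.compose (bracket.mor (bracket.mor f g) h) (J (t f) (t g) (t h))
        (by rw [s_J, bracket.t_mor, bracket.t_mor]) =
      toTwoVectorSpace.compose (J (s f) (s g) (s h))
        (bracket.mor f (bracket.mor g h) + bracket.mor (bracket.mor f h) g)
        ((t_J _ _ _).trans (by simp only [map_add, bracket.s_mor]; rfl))
  J_isIso : ∀ x y z, toTwoVectorSpace.IsIso (J x y z)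
  /-- The arrow part changes sign under the two adjacent transpositions, hence under every
  permutation by its sign. -/
  J_swap₁₂ : ∀ x y z, toTwoVectorSpace.arrow (J y x z) = -toTwoVectorSpace.arrow (J x y z)
  J_swap₂₃ : ∀ x y z, toTwoVectorSpace.arrow (J x z y) = -toTwoVectorSpace.arrow (J x y z)

namespace PreLieTwoAlgebra

variable {k : Type u} [Field k]

/-- The bracket of objects. -/
abbrev br (L : PreLieTwoAlgebra.{u, v} k) (x y : L.Ob) : L.Ob := L.bracket.obj x y

/-- The bracket of morphisms. -/
abbrev brM (L : PreLieTwoAlgebra.{u, v} k) (f g : L.Mor) : L.Mor := L.bracket.mor f g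

/-- The Jacobiator identity: both composites run from `[[[w,x],y],z]` to
`[[[w,z],y],x] + [[w,z],[x,y]] + [[w,y],[x,z]] + [w,[[x,z],y]] + [[w,[y,z]],x] + [w,[x,[y,z]]]`. -/
def JacobiatorIdentity (L : PreLieTwoAlgebra.{u, v} k) : Prop :=
  ∀ w x y z : L.Ob,
    L.compose
      (L.compose
        (L.J (L.br w x) y z)
        (L.brM (L.J w x z) (L.i y) + L.i (L.br (L.br w x) (L.br y z)))
        (by simp only [br, brM, L.t_J, map_add, L.bracket.s_mor, L.s_J, L.s_i]; abel))
      (L.J w (L.br x z) y + L.J (L.br w z) x y + L.J w x (L.br y z))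
      (by simp only [br, brM, TwoVectorSpace.t_compose, L.t_J, map_add, L.bracket.t_mor, L.s_J,
            L.t_i, LinearMap.add_apply]) =
    L.compose
      (L.compose
        (L.compose
          (L.brM (L.J w x y) (L.i z))
          (L.J (L.br w y) x z + L.J w (L.br x y) z)
          (by simp only [br, brM, L.t_J, map_add, L.bracket.t_mor, L.s_J, L.t_i,
                LinearMap.add_apply]; abel))
        (L.brM (L.J w y z) (L.i x) +
          L.i (L.br (L.br w y) (L.br x z) + L.br w (L.br (L.br x y) z) +
            L.br (L.br w z) (L.br x y)))
        (by simp only [br, brM, TwoVectorSpace.t_compose, L.t_J, map_add, L.bracket.s_mor, L.s_J,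
              L.s_i]; abel))
      (L.brM (L.i w) (L.J x y z) +
        L.i (L.br (L.br (L.br w z) y) x + L.br (L.br w (L.br y z)) x +
          L.br (L.br w y) (L.br x z) + L.br (L.br w z) (L.br x y)))
      (by simp only [br, brM, TwoVectorSpace.t_compose, L.t_J, map_add, L.bracket.s_mor,
            L.bracket.t_mor, L.s_J, L.s_i, L.t_i, LinearMap.add_apply]; abel)

end PreLieTwoAlgebra

/-- A semistrict Lie 2-algebra. -/
structure LieTwoAlgebra (k : Type u) [Field k] extends PreLieTwoAlgebra.{u, v} k where
  jacobiator_identity : toPreLieTwoAlgebra.JacobiatorIdentity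

namespace LieTwoAlgebra

variable {k : Type u} [Field k]

/-- The data of a homomorphism of Lie 2-algebras, before the compatibility with the Jacobiators:
a linear functor `F` and a skew-symmetric bilinear natural transformation
`F₂ x y : [F₀ x, F₀ y] → F₀ [x, y]`. -/
structure PreHom (L L' : LieTwoAlgebra.{u, v} k) extends
    LinearFunctor L.toTwoVectorSpace L'.toTwoVectorSpace where
  F₂ : L.Ob →ₗ[k] L.Ob →ₗ[k] L'.Mor
  s_F₂ : ∀ x y, L'.s (F₂ x y) = L'.br (obj x) (obj y)
  t_F₂ : ∀ x y, L'.t (F₂ x y) = obj (L.br x y)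
  F₂_natural : ∀ f g : L.Mor,
    L'.compose (L'.brM (mor f) (mor g)) (F₂ (L.t f) (L.t g))
        (by rw [L'.bracket.t_mor, t_mor, t_mor, s_F₂]) =
      L'.compose (F₂ (L.s f) (L.s g)) (mor (L.brM f g))
        (by rw [t_F₂, s_mor, L.bracket.s_mor])
  F₂_skew : ∀ x y, F₂ x y = -F₂ y x

/-- A homomorphism of Lie 2-algebras: the two composites
`[[F₀x,F₀y],F₀z] → [F₀[x,y],F₀z] → F₀[[x,y],z] → F₀([x,[y,z]] + [[x,z],y])` and
`[[F₀x,F₀y],F₀z] → [F₀x,[F₀y,F₀z]] + [[F₀x,F₀z],F₀y] → [F₀x,F₀[y,z]] + [F₀[x,z],F₀y] →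
F₀[x,[y,z]] + F₀[[x,z],y]` agree. -/
structure Hom (L L' : LieTwoAlgebra.{u, v} k) extends PreHom L L' where
  coherence : ∀ x y z : L.Ob,
    L'.compose
      (L'.compose (L'.brM (F₂ x y) (L'.i (obj z))) (F₂ (L.br x y) z)
        (by rw [L'.bracket.t_mor, t_F₂, L'.t_i, s_F₂]))
      (mor (L.J x y z))
      (by rw [TwoVectorSpace.t_compose, t_F₂, s_mor, L.s_J]) =
    L'.compose
      (L'.compose (L'.J (obj x) (obj y) (obj z))
        (L'.brM (L'.i (obj x)) (F₂ y z) + L'.brM (F₂ x z) (L'.i (obj y)))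
        (by simp only [L'.t_J, map_add, L'.bracket.s_mor, L'.s_i, s_F₂]))
      (F₂ x (L.br y z) + F₂ (L.br x z) y)
      (by simp only [TwoVectorSpace.t_compose, map_add, L'.bracket.t_mor, L'.t_i, s_F₂, t_F₂])

/-- A 2-homomorphism `F ⇒ G`: a linear natural transformation `θ` with
`F₂(x,y) θ_[x,y] = [θ_x, θ_y] G₂(x,y)`. -/
@[ext]
structure TwoHom {L L' : LieTwoAlgebra.{u, v} k} (F G : Hom L L') where
  θ : L.Ob →ₗ[k] L'.Mor
  s_θ : ∀ x, L'.s (θ x) = F.obj x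
  t_θ : ∀ x, L'.t (θ x) = G.obj x
  θ_natural : ∀ f : L.Mor,
    L'.compose (F.mor f) (θ (L.t f)) (by rw [F.t_mor, s_θ]) =
      L'.compose (θ (L.s f)) (G.mor f) (by rw [t_θ, G.s_mor])
  θ_bracket : ∀ x y : L.Ob,
    L'.compose (F.F₂ x y) (θ (L.br x y)) (by rw [F.t_F₂, s_θ]) =
      L'.compose (L'.brM (θ x) (θ y)) (G.F₂ x y) (by rw [L'.bracket.t_mor, t_θ, t_θ, G.s_F₂])

namespace Hom

variable {L L' L'' : LieTwoAlgebra.{u, v} k}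

/-- The identity homomorphism. -/
def id (L : LieTwoAlgebra.{u, v} k) : Hom L L where
  obj := LinearMap.id
  mor := LinearMap.id
  s_mor _ := rfl
  t_mor _ := rfl
  mor_i _ := rfl
  mor_comp _ _ _ := rfl
  F₂ := L.bracket.obj.compr₂ L.i
  s_F₂ x y := by simp
  t_F₂ x y := by simp
  F₂_natural f g := by
    simp [TwoVectorSpace.compose_eq, L.bracket.t_mor]
  F₂_skew x y := by
    simp only [LinearMap.compr₂_apply]
    rw [L.bracket_skew.obj x y, map_neg]
  coherence x y z := by
    change L.compose (L.compose (L.brM (L.i (L.br x y)) (L.i z)) (L.i (L.br (L.br x y) z)) _)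
      (L.J x y z) _ = L.compose (L.compose (L.J x y z)
        (L.brM (L.i x) (L.i (L.br y z)) + L.brM (L.i (L.br x z)) (L.i y)) _)
        (L.i (L.br x (L.br y z)) + L.i (L.br (L.br x z) y)) _
    simp only [TwoVectorSpace.compose_eq, PreLieTwoAlgebra.brM, PreLieTwoAlgebra.br,
      L.bracket.mor_i, map_add, map_sub, L.t_i, L.t_J]
    abel

/-- The composite `F G : L → L''`, with `(F G)₂ (x, y)` the composite
`[G₀F₀x, G₀F₀y] → G₀[F₀x, F₀y] → G₀F₀[x, y]`. -/
def comp (F : Hom L L') (G : Hom L' L'') : Hom L L'' where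
  obj := G.obj ∘ₗ F.obj
  mor := G.mor ∘ₗ F.mor
  s_mor f := by simp [G.s_mor, F.s_mor]
  t_mor f := by simp [G.t_mor, F.t_mor]
  mor_i x := by simp [G.mor_i, F.mor_i]
  mor_comp f g h := by simp [G.mor_comp, F.mor_comp]
  F₂ := LinearMap.mk₂ k
    (fun x y => L''.compose (G.F₂ (F.obj x) (F.obj y)) (G.mor (F.F₂ x y))
      (by rw [G.t_F₂, G.s_mor, F.s_F₂]))
    (fun x x' y => by simp [TwoVectorSpace.compose_eq]; abel)
    (fun c x y => by simp [TwoVectorSpace.compose_eq, smul_sub])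
    (fun x y y' => by simp [TwoVectorSpace.compose_eq]; abel)
    (fun c x y => by simp [TwoVectorSpace.compose_eq, smul_sub])
  s_F₂ x y := by simp [G.s_F₂]
  t_F₂ x y := by simp [G.t_mor, F.t_F₂]
  F₂_natural f g := by
    have h1 := G.F₂_natural (F.mor f) (F.mor g)
    have h2 := congrArg G.mor (F.F₂_natural f g)
    simp only [TwoVectorSpace.compose_eq, LinearMap.mk₂_apply, LinearMap.comp_apply, map_add,
      map_sub, G.mor_i, L''.bracket.t_mor, L'.bracket.t_mor, G.t_mor, F.t_mor, G.t_F₂, F.t_F₂,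
      F.s_mor, L''.t_i] at h1 h2 ⊢
    linear_combination (norm := abel) h1 + h2
  F₂_skew x y := by
    have h1 := G.F₂_skew (F.obj x) (F.obj y)
    have h2 := F.F₂_skew x y
    have h3 := L'.bracket_skew.obj (F.obj x) (F.obj y)
    simp only [TwoVectorSpace.compose_eq, LinearMap.mk₂_apply, G.t_F₂]
    rw [h1, h2, PreLieTwoAlgebra.br, h3]
    simp only [map_neg]
    abel
  coherence x y z := by
    have h0 := G.coherence (F.obj x) (F.obj y) (F.obj z)
    have h1 := congrArg G.mor (F.coherence x y z)
    have h2 := G.F₂_natural (F.F₂ x y) (L'.i (F.obj z))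
    have h3 := G.F₂_natural (L'.i (F.obj x)) (F.F₂ y z)
    have h4 := G.F₂_natural (F.F₂ x z) (L'.i (F.obj y))
    simp only [PreLieTwoAlgebra.brM, PreLieTwoAlgebra.br] at h0 h1 h2 h3 h4 ⊢
    simp only [TwoVectorSpace.compose_eq, LinearMap.mk₂_apply, LinearMap.comp_apply, map_add,
      map_sub, G.mor_i, L''.bracket.t_mor, L'.bracket.t_mor, L''.bracket.mor_i,
      G.t_mor, G.t_F₂, F.t_F₂, F.s_F₂, L''.t_J, L'.t_J, LinearMap.add_apply,
      LinearMap.sub_apply, L''.t_i, L'.t_i, L'.s_i, PreLieTwoAlgebra.br] at h0 h1 h2 h3 h4 ⊢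
    linear_combination (norm := abel) h0 + h1 + h2 - h3 - h4

end Hom

namespace TwoHom

variable {L L' L'' : LieTwoAlgebra.{u, v} k}

/-- The identity 2-homomorphism. -/
def id (F : Hom L L') : TwoHom F F where
  θ := L'.i ∘ₗ F.obj
  s_θ x := by simp
  t_θ x := by simp
  θ_natural f := by simp [TwoVectorSpace.compose_eq, F.t_mor]
  θ_bracket x y := by
    simp [TwoVectorSpace.compose_eq, F.t_F₂, L'.bracket.mor_i]

/-- Vertical composition of 2-homomorphisms. -/
def vcomp {F G H : Hom L L'} (α : TwoHom F G) (β : TwoHom G H) : TwoHom F H where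
  θ :=
    { toFun := fun x => L'.compose (α.θ x) (β.θ x) (by rw [α.t_θ, β.s_θ])
      map_add' := fun x y => by simp [TwoVectorSpace.compose_eq]; abel
      map_smul' := fun c x => by simp [TwoVectorSpace.compose_eq, smul_sub] }
  s_θ x := by simp [α.s_θ]
  t_θ x := by simp [β.t_θ]
  θ_natural f := by
    have h1 := α.θ_natural f
    have h2 := β.θ_natural f
    simp only [TwoVectorSpace.compose_eq, LinearMap.coe_mk, AddHom.coe_mk, map_add, map_sub,
      α.t_θ, β.t_θ, F.t_mor, G.t_mor, L'.t_i] at h1 h2 ⊢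
    linear_combination (norm := abel) h1 + h2
  θ_bracket x y := by
    have h1 := α.θ_bracket x y
    have h2 := β.θ_bracket x y
    have h3 := L'.bracket.mor_comp (α.θ x) (β.θ x) (α.θ y) (β.θ y) (by rw [α.t_θ, β.s_θ])
      (by rw [α.t_θ, β.s_θ])
    simp only [LinearMap.coe_mk, AddHom.coe_mk, PreLieTwoAlgebra.brM] at h3 ⊢
    simp only [h3]
    simp only [TwoVectorSpace.compose_eq, map_add, map_sub, L'.bracket.t_mor, PreLieTwoAlgebra.br,
      α.t_θ, β.t_θ, F.t_F₂, G.t_F₂, L'.t_i] at h1 h2 ⊢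
    linear_combination (norm := abel) h1 + h2

/-- A 2-homomorphism is invertible if it has an inverse under vertical composition. -/
def IsInvertible {F G : Hom L L'} (α : TwoHom F G) : Prop :=
  ∃ β : TwoHom G F, α.vcomp β = id F ∧ β.vcomp α = id G

theorem isInvertible {F G : Hom L L'} (α : TwoHom F G) : α.IsInvertible := by
  refine ⟨⟨L'.i ∘ₗ F.obj + L'.i ∘ₗ G.obj - α.θ, ?_, ?_, ?_, ?_⟩, ?_, ?_⟩
  · intro x; simp [α.s_θ]
  · intro x; simp [α.t_θ]
  · intro f
    have h1 := α.θ_natural f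
    simp only [TwoVectorSpace.compose_eq, LinearMap.add_apply, LinearMap.sub_apply,
      LinearMap.comp_apply, map_add, map_sub,
      α.t_θ, F.t_mor, G.t_mor, L'.t_i] at h1 ⊢
    linear_combination (norm := abel) -h1
  · intro x y
    have h1 := α.θ_bracket x y
    have h2 := L'.bracket.mor_comp (α.θ x) (L'.i (F.obj x) + L'.i (G.obj x) - α.θ x)
      (α.θ y) (L'.i (F.obj y) + L'.i (G.obj y) - α.θ y) (by simp [α.t_θ, α.s_θ]) (by simp [α.t_θ, α.s_θ])
    simp only [TwoVectorSpace.compose_eq, α.t_θ] at h2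
    rw [show α.θ x + (L'.i (F.obj x) + L'.i (G.obj x) - α.θ x) - L'.i (G.obj x) =
      L'.i (F.obj x) by abel, show α.θ y + (L'.i (F.obj y) + L'.i (G.obj y) - α.θ y) -
      L'.i (G.obj y) = L'.i (F.obj y) by abel, L'.bracket.mor_i, L'.bracket.t_mor,
      α.t_θ, α.t_θ] at h2
    simp only [PreLieTwoAlgebra.brM, LinearMap.add_apply, LinearMap.sub_apply,
      LinearMap.comp_apply, TwoVectorSpace.compose_eq, G.t_F₂]
    simp only [TwoVectorSpace.compose_eq, PreLieTwoAlgebra.brM, L'.bracket.t_mor, α.t_θ,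
      F.t_F₂] at h1
    rw [show L'.t (L'.bracket.mor (L'.i (F.obj x) + L'.i (G.obj x) - α.θ x)
      (L'.i (F.obj y) + L'.i (G.obj y) - α.θ y)) = L'.bracket.obj (F.obj x) (F.obj y) by
        rw [L'.bracket.t_mor]; simp [α.t_θ]]
    linear_combination (norm := abel) h2 - h1
  · ext x
    simp [vcomp, id, TwoVectorSpace.compose_eq, α.t_θ]
  · ext x
    simp [vcomp, id, TwoVectorSpace.compose_eq, α.t_θ]

end TwoHom

/-- Two Lie 2-algebras are equivalent (as objects of the 2-category of Lie 2-algebras) if there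
are homomorphisms `F : L → L'` and `G : L' → L` and invertible 2-homomorphisms `F G ⇒ 1_L` and
`G F ⇒ 1_L'`. -/
def Equivalent (L L' : LieTwoAlgebra.{u, v} k) : Prop :=
  ∃ (F : Hom L L') (G : Hom L' L) (α : TwoHom (F.comp G) (Hom.id L))
    (β : TwoHom (G.comp F) (Hom.id L')), α.IsInvertible ∧ β.IsInvertible

/-- From `F G ⇒ 1` and `H K ⇒ 1` one gets `(F H) (K G) ⇒ 1`. -/
theorem nonempty_twoHom_comp {L M N : LieTwoAlgebra.{u, v} k} (F : Hom L M) (G : Hom M L)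
    (H : Hom M N) (K : Hom N M) (α : TwoHom (F.comp G) (Hom.id L))
    (β : TwoHom (H.comp K) (Hom.id M)) :
    Nonempty (TwoHom ((F.comp H).comp (K.comp G)) (Hom.id L)) := by
  have hβs : ∀ x, M.s (β.θ x) = K.obj (H.obj x) := β.s_θ
  have hβt : ∀ x, M.t (β.θ x) = x := β.t_θ
  have hαs : ∀ x, L.s (α.θ x) = G.obj (F.obj x) := α.s_θ
  have hαt : ∀ x, L.t (α.θ x) = x := α.t_θ
  refine ⟨⟨G.mor ∘ₗ β.θ ∘ₗ F.obj + α.θ - L.i ∘ₗ G.obj ∘ₗ F.obj, ?_, ?_, ?_, ?_⟩⟩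
  · intro x; simp [Hom.comp, G.s_mor, hβs, hαs]
  · intro x; simp [Hom.id, G.t_mor, hβt, hαt]
  · intro f
    have h1 := α.θ_natural f
    have h2 := congrArg G.mor (β.θ_natural (F.mor f))
    simp only [TwoVectorSpace.compose_eq, Hom.comp, Hom.id, LinearMap.add_apply,
      LinearMap.sub_apply, LinearMap.comp_apply, LinearMap.id_apply, map_add, map_sub,
      G.mor_i, G.t_mor, F.t_mor, F.s_mor, H.t_mor, K.t_mor, hβt, hαt, L.t_i] at h1 h2 ⊢
    linear_combination (norm := abel) h1 + h2
  · intro x y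
    have h1 := α.θ_bracket x y
    have h2 := congrArg G.mor (β.θ_bracket (F.obj x) (F.obj y))
    have h3 := G.F₂_natural (β.θ (F.obj x)) (β.θ (F.obj y))
    have h4 := congrArg G.mor (β.θ_natural (F.F₂ x y))
    have h5 := L.bracket.mor_comp (G.mor (β.θ (F.obj x))) (α.θ x) (G.mor (β.θ (F.obj y)))
      (α.θ y) (by rw [G.t_mor, hβt, hαs]) (by rw [G.t_mor, hβt, hαs])
    simp only [PreLieTwoAlgebra.brM, PreLieTwoAlgebra.br] at h1 h2 h3 h4 h5 ⊢
    simp only [TwoVectorSpace.compose_eq, G.t_mor, hβt] at h5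
    have h6 : L.bracket.mor (G.mor (β.θ (F.obj x)) + α.θ x - L.i (G.obj (F.obj x)))
        (G.mor (β.θ (F.obj y)) + α.θ y - L.i (G.obj (F.obj y))) = _ := h5
    simp only [LinearMap.add_apply, LinearMap.sub_apply, LinearMap.comp_apply]
    simp only [TwoVectorSpace.compose_eq, h6]
    simp only [TwoVectorSpace.compose_eq, Hom.comp, Hom.id, LinearMap.mk₂_apply,
      LinearMap.comp_apply, LinearMap.id_apply, LinearMap.compr₂_apply, map_add, map_sub,
      G.mor_i, K.mor_i, G.t_mor, K.t_mor, H.t_mor, L.bracket.t_mor, M.bracket.t_mor,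
      F.t_F₂, F.s_F₂, G.t_F₂, H.t_F₂, K.t_F₂, hβt, hβs, hαt, L.t_i, M.t_i, PreLieTwoAlgebra.br]
      at h1 h2 h3 h4 ⊢
    linear_combination (norm := abel) h1 + h2 - h3 + h4

theorem equivalent_equivalence : Equivalence (Equivalent (k := k) : _ → _ → Prop) where
  refl L := by
    have : TwoHom ((Hom.id L).comp (Hom.id L)) (Hom.id L) := by
      refine ⟨L.i, ?_, ?_, ?_, ?_⟩
      · intro x; simp [Hom.comp, Hom.id]
      · intro x; simp [Hom.id]
      · intro f; simp [Hom.comp, Hom.id, TwoVectorSpace.compose_eq]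
      · intro x y; simp [Hom.comp, Hom.id, TwoVectorSpace.compose_eq, L.bracket.mor_i]
    exact ⟨Hom.id L, Hom.id L, this, this, this.isInvertible, this.isInvertible⟩
  symm := by
    rintro L L' ⟨F, G, α, β, hα, hβ⟩
    exact ⟨G, F, β, α, hβ, hα⟩
  trans := by
    rintro L M N ⟨F, G, α, β, -, -⟩ ⟨H, K, γ, δ, -, -⟩
    obtain ⟨ε⟩ := nonempty_twoHom_comp F G H K α γ
    obtain ⟨ζ⟩ := nonempty_twoHom_comp K H G F δ β
    exact ⟨F.comp H, K.comp G, ε, ζ, ε.isInvertible, ζ.isInvertible⟩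

end LieTwoAlgebra

/-! ### Third Lie algebra cohomology and quadruples -/

namespace LieCohomology

open LieModule.Cohomology

section

variable (k : Type u) [Field k] (g : Type v) [LieRing g] [LieAlgebra k g]
  (V : Type v) [AddCommGroup V] [Module k V] [LieRingModule g V] [LieModule k g V]

/-- The 3-cocycles `Z³(g, V)` of the Chevalley-Eilenberg complex: alternating trilinear maps
`ω` with `δω = 0`. -/
def threeCocycle : Submodule k (g →ₗ[k] g →ₗ[k] g →ₗ[k] V) where
  carrier := {ω | (∀ x y, ω x x y = 0) ∧ (∀ x y, ω x y y = 0) ∧ ∀ w x y z,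
    ⁅w, ω x y z⁆ - ⁅x, ω w y z⁆ + ⁅y, ω w x z⁆ - ⁅z, ω w x y⁆
      - ω ⁅w, x⁆ y z + ω ⁅w, y⁆ x z - ω ⁅w, z⁆ x y
      - ω ⁅x, y⁆ w z + ω ⁅x, z⁆ w y - ω ⁅y, z⁆ w x = 0}
  zero_mem' := by simp
  add_mem' := by
    rintro a b ⟨ha1, ha2, ha3⟩ ⟨hb1, hb2, hb3⟩
    refine ⟨fun x y => by simp [ha1, hb1], fun x y => by simp [ha2, hb2], fun w x y z => ?_⟩
    have h1 := ha3 w x y z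
    have h2 := hb3 w x y z
    simp only [LinearMap.add_apply, lie_add]
    linear_combination (norm := abel) h1 + h2
  smul_mem' := by
    rintro c a ⟨ha1, ha2, ha3⟩
    refine ⟨fun x y => by simp [ha1], fun x y => by simp [ha2], fun w x y z => ?_⟩
    have h1 := congrArg (fun v => c • v) (ha3 w x y z)
    simpa only [LinearMap.smul_apply, lie_smul, smul_add, smul_sub, smul_zero] using h1

/-- The 3-coboundaries `B³(g, V)`: the image of `δ` on alternating bilinear maps. -/
def threeCoboundary : Submodule k (g →ₗ[k] g →ₗ[k] g →ₗ[k] V) :=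
  LinearMap.range (d₂₃ k g V)

theorem threeCoboundary_le : threeCoboundary k g V ≤ threeCocycle k g V := by
  rintro _ ⟨a, rfl⟩
  have sk : ∀ x y, a x y = - a y x := fun x y => (twoCochain_skew a y x).symm
  refine ⟨fun x y => ?_, fun x y => ?_, fun w x y z => ?_⟩
  · simp
  · rw [d₂₃_apply, sk ⁅x, y⁆ y]; simp
  · have j1 : ∀ p q r s : g, a ⁅⁅p, q⁆, r⁆ s = a ⁅p, ⁅q, r⁆⁆ s - a ⁅q, ⁅p, r⁆⁆ s :=
      fun p q r s => by rw [lie_lie, map_sub, LinearMap.sub_apply]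
    have j2 : ∀ p q r s : g, a ⁅⁅p, q⁆, r⁆ s = -a ⁅r, ⁅p, q⁆⁆ s :=
      fun p q r s => by rw [← lie_skew, map_neg, LinearMap.neg_apply]
    simp only [d₂₃_apply, lie_add, lie_sub]
    rw [j1 w x y z, j1 w x z y, j2 w y x z, j1 w y z x, j2 w z x y, j2 w z y x,
      j2 x y w z, j1 x y z w, j2 x z w y, j2 x z y w, j2 y z w x, j2 y z x w,
      sk ⁅y, z⁆ ⁅w, x⁆, sk ⁅x, z⁆ ⁅w, y⁆, sk ⁅x, y⁆ ⁅w, z⁆]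
    simp only [lie_lie w x (a y z), lie_lie w y (a x z), lie_lie w z (a x y),
      lie_lie x y (a w z), lie_lie x z (a w y), lie_lie y z (a w x)]
    abel

/-- The cohomology group `H³(g, V) = Z³(g, V) / B³(g, V)`. -/
abbrev H3 : Type v :=
  threeCocycle k g V ⧸ (threeCoboundary k g V).submoduleOf (threeCocycle k g V)

end

section

variable {k : Type u} [Field k] {g g' : Type v} [LieRing g] [LieAlgebra k g]
  [LieRing g'] [LieAlgebra k g']
  {V V' : Type v} [AddCommGroup V] [Module k V] [AddCommGroup V'] [Module k V']

/-- Transport of cochains along isomorphisms `φ : g ≃ g'` and `ψ : V ≃ V'`: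
`ω ↦ ψ ∘ ω ∘ (φ⁻¹ × φ⁻¹ × φ⁻¹)`. -/
def transport (φ : g ≃ₗ⁅k⁆ g') (ψ : V ≃ₗ[k] V') :
    (g →ₗ[k] g →ₗ[k] g →ₗ[k] V) ≃ₗ[k] (g' →ₗ[k] g' →ₗ[k] g' →ₗ[k] V') :=
  φ.toLinearEquiv.arrowCongr (φ.toLinearEquiv.arrowCongr (φ.toLinearEquiv.arrowCongr ψ))

@[simp]
theorem transport_apply (φ : g ≃ₗ⁅k⁆ g') (ψ : V ≃ₗ[k] V') (ω : g →ₗ[k] g →ₗ[k] g →ₗ[k] V)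
    (x y z : g') : transport φ ψ ω x y z = ψ (ω (φ.symm x) (φ.symm y) (φ.symm z)) := rfl

variable [LieRingModule g V] [LieModule k g V] [LieRingModule g' V'] [LieModule k g' V']

/-- The cohomology class of a cocycle. -/
def H3.mk (ω : threeCocycle k g V) : H3 k g V := Submodule.Quotient.mk ω

theorem transport_mem (φ : g ≃ₗ⁅k⁆ g') (ψ : V ≃ₗ[k] V')
    (h : ∀ (x : g) (v : V), ψ ⁅x, v⁆ = ⁅φ x, ψ v⁆) :
    ∀ ω ∈ threeCocycle k g V, transport φ ψ ω ∈ threeCocycle k g' V' := by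
  rintro ω ⟨h1, h2, h3⟩
  refine ⟨fun x y => by simp [h1], fun x y => by simp [h2], fun w x y z => ?_⟩
  have e := congrArg ψ (h3 (φ.symm w) (φ.symm x) (φ.symm y) (φ.symm z))
  simpa only [map_add, map_sub, h, LieEquiv.apply_symm_apply, map_zero, transport_apply,
    LieEquiv.map_lie] using e

theorem transport_mem_coboundary (φ : g ≃ₗ⁅k⁆ g') (ψ : V ≃ₗ[k] V')
    (h : ∀ (x : g) (v : V), ψ ⁅x, v⁆ = ⁅φ x, ψ v⁆) :
    ∀ ω ∈ threeCoboundary k g V, transport φ ψ ω ∈ threeCoboundary k g' V' := by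
  rintro _ ⟨a, rfl⟩
  refine ⟨⟨φ.toLinearEquiv.arrowCongr (φ.toLinearEquiv.arrowCongr ψ) a.1, fun x => ?_⟩, ?_⟩
  · change ψ (a (φ.symm x) (φ.symm x)) = 0
    simp
  · ext x y z
    change ⁅x, ψ (a (φ.symm y) (φ.symm z))⁆ - ⁅y, ψ (a (φ.symm x) (φ.symm z))⁆ +
      ⁅z, ψ (a (φ.symm x) (φ.symm y))⁆ - ψ (a (φ.symm ⁅x, y⁆) (φ.symm z)) +
      ψ (a (φ.symm ⁅x, z⁆) (φ.symm y)) - ψ (a (φ.symm ⁅y, z⁆) (φ.symm x)) = _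
    simp only [transport_apply, d₂₃_apply, map_add, map_sub, h, LieEquiv.apply_symm_apply,
      LieEquiv.map_lie]

/-- The map `H³(g, V) → H³(g', V')` induced by an isomorphism of representations. -/
def H3.map (φ : g ≃ₗ⁅k⁆ g') (ψ : V ≃ₗ[k] V') (h : ∀ (x : g) (v : V), ψ ⁅x, v⁆ = ⁅φ x, ψ v⁆) :
    H3 k g V →ₗ[k] H3 k g' V' :=
  Submodule.mapQ _ _
    ((transport φ ψ).toLinearMap.restrict (transport_mem φ ψ h))
    (fun ω hω => transport_mem_coboundary φ ψ h ω.1 hω)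

end

end LieCohomology

/-- A quadruple `(g, V, ρ, c)`: a Lie algebra `g`, a vector space `V`, a representation of `g` on
`V` (written `⁅x, v⁆ = ρ(x) v`), and a class `c ∈ H³(g, V)`. -/
structure LieQuadruple (k : Type u) [Field k] where
  g : Type v
  V : Type v
  [lieRing : LieRing g]
  [lieAlgebra : LieAlgebra k g]
  [addCommGroup : AddCommGroup V]
  [module : Module k V]
  [lieRingModule : LieRingModule g V]
  [lieModule : LieModule k g V]
  cls : LieCohomology.H3 k g V

namespace LieQuadruple

attribute [instance] lieRing lieAlgebra addCommGroup module lieRingModule lieModule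

variable {k : Type u} [Field k]

/-- Isomorphism of quadruples: a Lie algebra isomorphism `φ` and a linear isomorphism `ψ`
intertwining the representations, whose induced map on `H³` matches the classes. -/
def Isomorphic (Q Q' : LieQuadruple.{u, v} k) : Prop :=
  ∃ (φ : Q.g ≃ₗ⁅k⁆ Q'.g) (ψ : Q.V ≃ₗ[k] Q'.V)
    (h : ∀ (x : Q.g) (v : Q.V), ψ ⁅x, v⁆ = ⁅φ x, ψ v⁆),
    LieCohomology.H3.map φ ψ h Q.cls = Q'.cls

theorem isomorphic_equivalence : Equivalence (Isomorphic (k := k) : _ → _ → Prop) where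
  refl Q := by
    refine ⟨LieEquiv.refl, LinearEquiv.refl k _, fun x v => rfl, ?_⟩
    obtain ⟨ω, hω⟩ := Submodule.Quotient.mk_surjective _ Q.cls
    rw [← hω]
    rfl
  symm := by
    rintro Q Q' ⟨φ, ψ, h, e⟩
    refine ⟨φ.symm, ψ.symm, fun x v => ?_, ?_⟩
    · apply ψ.injective
      rw [h]
      simp
    · rw [← e]
      obtain ⟨ω, hω⟩ := Submodule.Quotient.mk_surjective _ Q.cls
      rw [← hω]
      refine congrArg Submodule.Quotient.mk (Subtype.ext ?_)
      ext x y z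
      change ψ.symm (ψ (ω.1 (φ.symm (φ x)) (φ.symm (φ y)) (φ.symm (φ z)))) = _
      simp
  trans := by
    rintro Q Q' Q'' ⟨φ, ψ, h, e⟩ ⟨φ', ψ', h', e'⟩
    refine ⟨φ.trans φ', ψ.trans ψ', fun x v => ?_, ?_⟩
    · simp [h, h']
    · rw [← e', ← e]
      obtain ⟨ω, hω⟩ := Submodule.Quotient.mk_surjective _ Q.cls
      rw [← hω]
      rfl

end LieQuadruple

/-! ### Classes, and the Lie 2-algebra of a cocycle -/

/-- The equivalence classes of Lie 2-algebras over `k`. -/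
def LieTwoAlgebraClass (k : Type u) [Field k] : Type (max u (v + 1)) :=
  Quotient (⟨LieTwoAlgebra.Equivalent, LieTwoAlgebra.equivalent_equivalence⟩ :
    Setoid (LieTwoAlgebra.{u, v} k))

/-- The equivalence class of a Lie 2-algebra. -/
def LieTwoAlgebra.toClass {k : Type u} [Field k] (L : LieTwoAlgebra.{u, v} k) :
    LieTwoAlgebraClass.{u, v} k := Quotient.mk _ L

/-- The isomorphism classes of quadruples over `k`. -/
def LieQuadrupleClass (k : Type u) [Field k] : Type (max u (v + 1)) :=
  Quotient (⟨LieQuadruple.Isomorphic, LieQuadruple.isomorphic_equivalence⟩ :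
    Setoid (LieQuadruple.{u, v} k))

/-- The isomorphism class of a quadruple. -/
def LieQuadruple.toClass {k : Type u} [Field k] (Q : LieQuadruple.{u, v} k) :
    LieQuadrupleClass.{u, v} k := Quotient.mk _ Q

namespace LieTwoAlgebra

section

variable {k : Type u} [Field k] {g : Type v} [LieRing g] [LieAlgebra k g]
  {V : Type v} [AddCommGroup V] [Module k V] [LieRingModule g V] [LieModule k g V]

variable (k g V) in
/-- The skeletal 2-vector space with objects `g` and morphisms `g × V`, where `(x, v) : x → x`
and `(x, v) (x, v') = (x, v + v')`. -/
def skeletalTwoVectorSpace : TwoVectorSpace.{u, v} k where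
  Ob := g
  Mor := g × V
  s := LinearMap.fst k g V
  t := LinearMap.fst k g V
  i := LinearMap.inl k g V
  comp :=
    { toFun := fun p => (p.1.1.1, p.1.1.2 + p.1.2.2)
      map_add' := fun p q => by ext <;> simp; abel
      map_smul' := fun c p => by ext <;> simp }
  s_i _ := rfl
  t_i _ := rfl
  s_comp _ _ _ := rfl
  t_comp _ _ h := h
  id_comp f := by ext <;> simp
  comp_id f := by ext <;> simp
  assoc f g h _ _ := by ext <;> simp [add_assoc]

variable (k g) in
/-- The Lie bracket of `g` as a bilinear map. -/
def skeletalBr : g →ₗ[k] g →ₗ[k] g :=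
  LinearMap.mk₂ k (fun x y => ⁅x, y⁆) (fun _ _ _ => add_lie _ _ _)
    (fun _ _ _ => smul_lie _ _ _) (fun _ _ _ => lie_add _ _ _) (fun _ _ _ => lie_smul _ _ _)

variable (k g V) in
/-- The bilinear map `[(x, v), (y, w)] = ([x, y], ρ(x) w - ρ(y) v)`. -/
def skeletalBrM : g × V →ₗ[k] g × V →ₗ[k] g × V :=
  LinearMap.mk₂ k (fun a b => (⁅a.1, b.1⁆, ⁅a.1, b.2⁆ - ⁅b.1, a.2⁆))
    (fun _ _ _ => by ext <;> simp; abel) (fun _ _ _ => by ext <;> simp [smul_sub])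
    (fun _ _ _ => by ext <;> simp; abel) (fun _ _ _ => by ext <;> simp [smul_sub])

variable (k g V) in
/-- The bracket functor of the skeletal Lie 2-algebra. -/
def skeletalBracket : BilinearFunctor (skeletalTwoVectorSpace k g V)
    (skeletalTwoVectorSpace k g V) (skeletalTwoVectorSpace k g V) where
  obj := skeletalBr k g
  mor := skeletalBrM k g V
  s_mor _ _ := rfl
  t_mor _ _ := rfl
  mor_i := fun (x y : g) => by
    change ((⁅x, y⁆, ⁅x, (0 : V)⁆ - ⁅y, (0 : V)⁆) : g × V) = (⁅x, y⁆, 0)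
    simp
  mor_comp := fun (f f' a a' : g × V) (hf : f.1 = f'.1) (ha : a.1 = a'.1) => by
    change ((⁅f.1, a.1⁆, ⁅f.1, a.2 + a'.2⁆ - ⁅a.1, f.2 + f'.2⁆) : g × V) =
      (⁅f.1, a.1⁆, ⁅f.1, a.2⁆ - ⁅a.1, f.2⁆ + (⁅f'.1, a'.2⁆ - ⁅a'.1, f'.2⁆))
    rw [← hf, ← ha]
    simp only [lie_add]
    congr 1
    abel

/-- The Jacobiator `J x y z = ([[x, y], z], ω(x, y, z))`. -/
def skeletalJ (ω : g →ₗ[k] g →ₗ[k] g →ₗ[k] V) : g →ₗ[k] g →ₗ[k] g →ₗ[k] g × V where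
  toFun x :=
    { toFun := fun y =>
        { toFun := fun z => (⁅⁅x, y⁆, z⁆, ω x y z)
          map_add' := fun _ _ => by simp
          map_smul' := fun _ _ => by simp }
      map_add' := fun _ _ => by ext <;> simp
      map_smul' := fun _ _ => by ext <;> simp }
  map_add' _ _ := by ext <;> simp
  map_smul' _ _ := by ext <;> simp

theorem leibniz_left {g : Type v} [LieRing g] (x y z : g) :
    ⁅⁅x, y⁆, z⁆ = ⁅x, ⁅y, z⁆⁆ + ⁅⁅x, z⁆, y⁆ := by
  rw [lie_lie, ← lie_skew y ⁅x, z⁆]; abel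

/-- The skeletal Lie 2-algebra of a Lie algebra `g`, a representation of `g` on `V` and a
3-cocycle `ω`. -/
def ofCocycle (ω : LieCohomology.threeCocycle k g V) : LieTwoAlgebra.{u, v} k where
  toTwoVectorSpace := skeletalTwoVectorSpace k g V
  bracket := skeletalBracket k g V
  bracket_skew :=
    { obj := fun (x y : g) => (lie_skew x y).symm
      mor := fun (a b : g × V) => by
        change ((⁅a.1, b.1⁆, ⁅a.1, b.2⁆ - ⁅b.1, a.2⁆) : g × V) =
          -(⁅b.1, a.1⁆, ⁅b.1, a.2⁆ - ⁅a.1, b.2⁆)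
        rw [← lie_skew]
        simp }
  J := skeletalJ (g := g) (V := V) ω.1
  s_J _ _ _ := rfl
  t_J := fun (x y z : g) => leibniz_left (g := g) x y z
  J_natural := fun (f f' f'' : g × V) => by
    obtain ⟨x, a⟩ := f
    obtain ⟨y, b⟩ := f'
    obtain ⟨z, c⟩ := f''
    change ((⁅⁅x, y⁆, z⁆, (⁅⁅x, y⁆, c⁆ - ⁅z, ⁅x, b⁆ - ⁅y, a⁆⁆) + ω.1 x y z) : g × V) =
      (⁅⁅x, y⁆, z⁆, ω.1 x y z + ((⁅x, ⁅y, c⁆ - ⁅z, b⁆⁆ - ⁅⁅y, z⁆, a⁆) +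
        (⁅⁅x, z⁆, b⁆ - ⁅y, ⁅x, c⁆ - ⁅z, a⁆⁆)))
    simp only [lie_lie, lie_sub]
    congr 1
    abel
  J_isIso _ _ _ := TwoVectorSpace.isIso _ _
  J_swap₁₂ := fun (x y z : g) => by
    have h := ω.2.1 (x + y) z
    simp only [map_add, LinearMap.add_apply, ω.2.1] at h
    refine Prod.ext ?_ ?_
    · change ⁅⁅y, x⁆, z⁆ - ⁅⁅y, x⁆, z⁆ = -(⁅⁅x, y⁆, z⁆ - ⁅⁅x, y⁆, z⁆)
      simp
    · change ω.1 y x z - 0 = -(ω.1 x y z - 0)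
      simp only [sub_zero]
      linear_combination (norm := abel) h
  J_swap₂₃ := fun (x y z : g) => by
    have h := ω.2.2.1 x (y + z)
    simp only [map_add, LinearMap.add_apply, ω.2.2.1] at h
    refine Prod.ext ?_ ?_
    · change ⁅⁅x, z⁆, y⁆ - ⁅⁅x, z⁆, y⁆ = -(⁅⁅x, y⁆, z⁆ - ⁅⁅x, y⁆, z⁆)
      simp
    · change ω.1 x z y - 0 = -(ω.1 x y z - 0)
      simp only [sub_zero]
      linear_combination (norm := abel) h
  jacobiator_identity := fun (w x y z : g) => by
    have s12 : ∀ a b c : g, ω.1 b a c = -ω.1 a b c := fun a b c => by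
      have h := ω.2.1 (a + b) c
      simp only [map_add, LinearMap.add_apply, ω.2.1] at h
      linear_combination (norm := abel) h
    have s23 : ∀ a b c : g, ω.1 a c b = -ω.1 a b c := fun a b c => by
      have h := ω.2.2.1 a (b + c)
      simp only [map_add, LinearMap.add_apply, ω.2.2.1] at h
      linear_combination (norm := abel) h
    have e := ω.2.2.2 w x y z
    refine Prod.ext rfl ?_
    change ω.1 ⁅w, x⁆ y z + ((⁅⁅⁅w, x⁆, z⁆, (0 : V)⁆ - ⁅y, ω.1 w x z⁆) + 0) +
        (ω.1 w ⁅x, z⁆ y + ω.1 ⁅w, z⁆ x y + ω.1 w x ⁅y, z⁆) =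
      ((⁅⁅⁅w, x⁆, y⁆, (0 : V)⁆ - ⁅z, ω.1 w x y⁆) + (ω.1 ⁅w, y⁆ x z + ω.1 w ⁅x, y⁆ z) +
        ((⁅⁅⁅w, y⁆, z⁆, (0 : V)⁆ - ⁅x, ω.1 w y z⁆) + 0)) +
        ((⁅w, ω.1 x y z⁆ - ⁅⁅⁅x, y⁆, z⁆, (0 : V)⁆) + 0)
    rw [s12 ⁅x, z⁆ w y, s12 ⁅x, y⁆ w z, s23 w ⁅y, z⁆ x, s12 ⁅y, z⁆ w x]
    simp only [lie_zero]
    linear_combination (norm := abel) -e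

end

end LieTwoAlgebra

/-! ### Linear deformation retractions give equivalences -/

namespace LieTwoAlgebra

variable {k : Type u} [Field k]

/-! By `compose_eq` a composite `f g` is `f + g - 1`. So a 2-vector space amounts to the two-term
complex `t : ker s → Ob`, all morphisms are invertible, and every commuting diagram is a linear
identity between morphisms. A Lie 2-algebra becomes a two-term L∞-algebra: the Jacobi identity holds
up to `t` of the arrow part of `J`, and the Jacobiator identity says that this arrow part satisfies
the cocycle equation (`arrowJ_jacobi`).

Every Lie 2-algebra is equivalent to a skeletal one by homotopy transfer to homology. Put `g = Ob /
t(ker s)` and `V = ker s ∩ ker t`; the bracket induces a Lie bracket on `g` and a representation on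
`V`. Linear sections contract the complex onto `g` and `V` (`exists_splitting`). Correcting the
arrow part of `J` by the failure of the section to preserve brackets gives a 3-cocycle
(`transferred_cocycle`), whose skeletal Lie 2-algebra includes into `L`. This inclusion has a
retraction which is only a linear functor, but such a retraction always carries the structure of a
homomorphism, so the inclusion is an equivalence (`Retraction.equivalent`).

Between skeletal Lie 2-algebras, source equals target, so an equivalence is bijective on objects and
on `V`. What remains of `F₂` is a 2-cochain, and coherence says that its coboundary is the
difference of the two cocycles (`isomorphic_of_equivalent`, with converse
`equivalent_of_isomorphic`). Characteristic other than 2 makes skew-symmetric maps alternating. -/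

/-- A retraction of a homomorphism `F : M → L`: a linear functor `G : L → M` with `G ∘ F = 1`, and a
linear natural transformation `θ : F ∘ G ⇒ 1` which is trivial on the image of `F`. -/
structure Retraction {M L : LieTwoAlgebra.{u, v} k} (F : Hom M L) extends
    LinearFunctor L.toTwoVectorSpace M.toTwoVectorSpace where
  obj_obj : ∀ x, obj (F.obj x) = x
  mor_mor : ∀ f, mor (F.mor f) = f
  θ : L.Ob →ₗ[k] L.Mor
  s_θ : ∀ x, L.s (θ x) = F.obj (obj x)
  t_θ : ∀ x, L.t (θ x) = x
  θ_natural : ∀ f, F.mor (mor f) + θ (L.t f) - L.i (F.obj (obj (L.t f))) =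
    θ (L.s f) + f - L.i (L.s f)
  θ_obj : ∀ x, θ (F.obj x) = L.i (F.obj x)

namespace Retraction

variable {M L : LieTwoAlgebra.{u, v} k} {F : Hom M L}

theorem mor_injective (G : Retraction F) : Function.Injective F.mor :=
  Function.LeftInverse.injective G.mor_mor

/-- Naturality of `θ` at the morphism `θ x` itself, with `θ` trivial at its source, lets `θ x` be
cancelled: `F G (θ x)` is an identity, and `F` is injective on morphisms. -/
theorem mor_θ (G : Retraction F) (x : L.Ob) : G.mor (G.θ x) = M.i (G.obj x) := by
  apply G.mor_injective
  have h := G.θ_natural (G.θ x)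
  simp only [G.t_θ, G.s_θ, G.θ_obj] at h
  rw [F.mor_i]
  linear_combination (norm := abel) h

/-- The bracket of morphisms `f ≫ f'` and `g ≫ g'`, additively. -/
theorem _root_.BilinearFunctor.mor_add {V V' W : TwoVectorSpace.{u, v} k}
    (B : BilinearFunctor V V' W) (f f' : V.Mor) (g g' : V'.Mor) (hf : V.t f = V.s f')
    (hg : V'.t g = V'.s g') :
    B.mor (f + f' - V.i (V.t f)) (g + g' - V'.i (V'.t g)) =
      B.mor f g + B.mor f' g' - W.i (B.obj (V.t f) (V'.t g)) := by
  have h := B.mor_comp f f' g g' hf hg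
  simpa only [TwoVectorSpace.compose_eq, B.t_mor] using h

/-- The composite
`F[Gx, Gy] → [FGx, FGy] → [x, y] → FG[x, y]`. -/
def connecting (G : Retraction F) : L.Ob →ₗ[k] L.Ob →ₗ[k] L.Mor :=
  -- `F₂` and the last `θ` are traversed backwards: the inverse of `f` is `1_{s f} + 1_{t f} - f`,
  -- and the identities of the intermediate objects cancel.
  LinearMap.mk₂ k (fun x y => L.i (F.obj (M.br (G.obj x) (G.obj y))) - F.F₂ (G.obj x) (G.obj y) +
      L.brM (G.θ x) (G.θ y) - G.θ (L.br x y) + L.i (F.obj (G.obj (L.br x y))))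
    (fun x x' y => by simp [PreLieTwoAlgebra.brM, PreLieTwoAlgebra.br]; abel)
    (fun c x y => by simp [PreLieTwoAlgebra.brM, PreLieTwoAlgebra.br, smul_sub])
    (fun x y y' => by simp [PreLieTwoAlgebra.brM, PreLieTwoAlgebra.br]; abel)
    (fun c x y => by simp [PreLieTwoAlgebra.brM, PreLieTwoAlgebra.br, smul_sub])

theorem connecting_apply (G : Retraction F) (x y : L.Ob) : G.connecting x y =
    L.i (F.obj (M.br (G.obj x) (G.obj y))) - F.F₂ (G.obj x) (G.obj y) +
      L.brM (G.θ x) (G.θ y) - G.θ (L.br x y) + L.i (F.obj (G.obj (L.br x y))) := rfl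

theorem s_connecting (G : Retraction F) (x y : L.Ob) :
    L.s (G.connecting x y) = F.obj (M.br (G.obj x) (G.obj y)) := by
  simp [connecting_apply, F.s_F₂, L.bracket.s_mor, G.s_θ]

theorem t_connecting (G : Retraction F) (x y : L.Ob) :
    L.t (G.connecting x y) = F.obj (G.obj (L.br x y)) := by
  simp [connecting_apply, F.t_F₂, L.bracket.t_mor, G.t_θ]

/-- Both ends lie in the image of `F`, where `θ` is trivial, so naturality of `θ` says that `F G`
fixes this morphism. Thus `G.mor` of it is its lift along `F`, and identities about the lift can be
checked in `L`. -/
theorem mor_mor_connecting (G : Retraction F) (x y : L.Ob) :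
    F.mor (G.mor (G.connecting x y)) = G.connecting x y := by
  have h := G.θ_natural (G.connecting x y)
  simp only [G.s_connecting, G.t_connecting, G.θ_obj, G.obj_obj] at h
  linear_combination (norm := abel) h

/-- The bracket functor applied to the naturality squares of `θ` at `f` and `g`. -/
theorem bracket_natural (G : Retraction F) (f g : L.Mor) :
    L.brM (F.mor (G.mor f)) (F.mor (G.mor g)) + L.brM (G.θ (L.t f)) (G.θ (L.t g)) -
      L.i (L.br (F.obj (G.obj (L.t f))) (F.obj (G.obj (L.t g)))) =
    L.brM (G.θ (L.s f)) (G.θ (L.s g)) + L.brM f g - L.i (L.br (L.s f) (L.s g)) := by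
  have h1 := L.bracket.mor_add (F.mor (G.mor f)) (G.θ (L.t f)) (F.mor (G.mor g)) (G.θ (L.t g))
    (by rw [F.t_mor, G.t_mor, G.s_θ]) (by rw [F.t_mor, G.t_mor, G.s_θ])
  have h2 := L.bracket.mor_add (G.θ (L.s f)) f (G.θ (L.s g)) g (G.t_θ _) (G.t_θ _)
  simp only [F.t_mor, G.t_mor, G.t_θ] at h1 h2
  rw [← h1, ← h2, G.θ_natural, G.θ_natural]

/-- The homomorphism carried by a retraction, before coherence. -/
def preHom (G : Retraction F) : PreHom L M where
  toLinearFunctor := G.toLinearFunctor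
  F₂ := G.connecting.compr₂ G.mor
  s_F₂ x y := by
    rw [LinearMap.compr₂_apply, G.s_mor, s_connecting, G.obj_obj]
  t_F₂ x y := by
    rw [LinearMap.compr₂_apply, G.t_mor, t_connecting, G.obj_obj]
  F₂_natural f g := by
    apply G.mor_injective
    have h1 := F.F₂_natural (G.mor f) (G.mor g)
    have h2 := G.bracket_natural f g
    have h3 := G.θ_natural (L.brM f g)
    simp only [PreLieTwoAlgebra.brM, PreLieTwoAlgebra.br] at h1 h2 h3 ⊢
    simp only [TwoVectorSpace.compose_eq, LinearMap.compr₂_apply, map_add, map_sub,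
      mor_mor_connecting]
    simp only [TwoVectorSpace.compose_eq, L.bracket.t_mor, L.bracket.s_mor,
      M.bracket.t_mor, G.t_mor, G.s_mor, F.mor_i, F.t_mor, F.t_F₂, t_connecting,
      PreLieTwoAlgebra.br, G.obj_obj] at h1 h2 h3 ⊢
    simp only [connecting_apply, PreLieTwoAlgebra.brM, PreLieTwoAlgebra.br]
    linear_combination (norm := abel) h2 - h1 - h3
  F₂_skew x y := by
    have h1 := F.F₂_skew (G.obj x) (G.obj y)
    have h2 := L.bracket_skew.obj x y
    have h3 := M.bracket_skew.obj (G.obj x) (G.obj y)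
    have h4 := L.bracket_skew.mor (G.θ x) (G.θ y)
    simp only [LinearMap.compr₂_apply, connecting_apply, PreLieTwoAlgebra.brM,
      PreLieTwoAlgebra.br]
    rw [h1, h2, h3, h4]
    simp only [map_add, map_sub, map_neg]
    abel

/-- The homomorphism carried by a retraction. -/
def hom (G : Retraction F) : Hom L M where
  toPreHom := G.preHom
  coherence x y z := by
    apply G.mor_injective
    have h0 := F.coherence (G.obj x) (G.obj y) (G.obj z)
    have h1 := G.θ_natural (L.J x y z)
    have h2 := L.J_natural (G.θ x) (G.θ y) (G.θ z)
    have h3 := F.F₂_natural (G.mor (G.connecting x y)) (M.i (G.obj z))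
    have h4 := F.F₂_natural (M.i (G.obj x)) (G.mor (G.connecting y z))
    have h5 := F.F₂_natural (G.mor (G.connecting x z)) (M.i (G.obj y))
    simp only [PreLieTwoAlgebra.brM, PreLieTwoAlgebra.br] at h0 h1 h2 h3 h4 h5 ⊢
    simp only [preHom, LinearMap.compr₂_apply, TwoVectorSpace.compose_eq, map_add,
      map_sub, F.mor_i, L.bracket.t_mor, M.bracket.t_mor,
      G.t_mor, G.s_mor, F.t_F₂, L.t_J, M.t_J, L.s_J,
      s_connecting, t_connecting, G.s_θ, G.t_θ, mor_mor_connecting,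
      L.t_i, M.t_i, M.s_i, G.obj_obj,
      PreLieTwoAlgebra.br] at h0 h1 h2 h3 h4 h5 ⊢
    -- Interchange law: `[f, g]` is `[f, 1]` followed by `[1, g]`, and by `e2` also the two in the
    -- other order. This splits the brackets of `θ` with composites, which come from whiskering
    -- `connecting`.
    have e1 : ∀ f g, L.bracket.mor f g = L.bracket.mor f (L.i (L.s g)) +
        L.bracket.mor (L.i (L.t f)) g - L.i (L.bracket.obj (L.t f) (L.s g)) := fun f g => by
      have h := L.bracket.mor_add f (L.i (L.t f)) (L.i (L.s g)) g (by simp) (by simp)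
      simpa using h
    have e2 : ∀ f g, L.bracket.mor f g = L.bracket.mor (L.i (L.s f)) g +
        L.bracket.mor f (L.i (L.t g)) - L.i (L.bracket.obj (L.s f) (L.t g)) := fun f g => by
      have h := L.bracket.mor_add (L.i (L.s f)) f g (L.i (L.t g)) (by simp) (by simp)
      simpa using h
    have a1 := e1 (L.bracket.mor (G.θ x) (G.θ y)) (G.θ z)
    have a2 := e1 (G.θ (L.bracket.obj x y)) (G.θ z)
    have b1 := e2 (G.θ x) (L.bracket.mor (G.θ y) (G.θ z))
    have b2 := e2 (G.θ x) (G.θ (L.bracket.obj y z))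
    have c1 := e1 (L.bracket.mor (G.θ x) (G.θ z)) (G.θ y)
    have c2 := e1 (G.θ (L.bracket.obj x z)) (G.θ y)
    simp only [connecting_apply, map_add, map_sub, LinearMap.add_apply,
      LinearMap.sub_apply, L.bracket.t_mor, L.bracket.mor_i,
      G.s_θ, G.t_θ, PreLieTwoAlgebra.brM, PreLieTwoAlgebra.br]
      at a1 a2 b1 b2 c1 c2 h3 h4 h5 ⊢
    linear_combination (norm := abel) h1 + h2 - h0 - h3 + h4 + h5 - a1 + a2 + b1 - b2 + c1 - c2

/-- `F G` is the identity on objects and morphisms, and `mor_θ` makes its `F₂` trivial. On the other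
side `θ` is itself the 2-homomorphism: `connecting` is what the bracket condition on `θ` demands of
the lift. -/
theorem equivalent (G : Retraction F) : Equivalent M L := by
  let α : TwoHom (F.comp G.hom) (Hom.id M) :=
    { θ := M.i
      s_θ := fun x => (M.s_i x).trans (G.obj_obj x).symm
      t_θ := M.t_i
      θ_natural := fun f => by
        simp only [Hom.comp, Hom.id, hom, preHom, TwoVectorSpace.compose_eq,
          LinearMap.comp_apply, LinearMap.id_apply, G.mor_mor, M.t_i]
        abel
      θ_bracket := fun x y => by
        simp only [Hom.comp, Hom.id, hom, preHom, LinearMap.mk₂_apply, LinearMap.compr₂_apply,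
          TwoVectorSpace.compose_eq, M.bracket.mor_i, connecting_apply, map_add, map_sub,
          G.θ_obj, G.mor_i, G.obj_obj, L.bracket.mor_i, G.mor_θ,
          G.t_mor, F.t_F₂, M.t_i,
          PreLieTwoAlgebra.brM, PreLieTwoAlgebra.br]
        abel }
  let β : TwoHom (G.hom.comp F) (Hom.id L) :=
    { θ := G.θ
      s_θ := G.s_θ
      t_θ := G.t_θ
      θ_natural := fun f => by
        have h := G.θ_natural f
        simp only [Hom.comp, Hom.id, hom, preHom, TwoVectorSpace.compose_eq,
          LinearMap.comp_apply, LinearMap.id_apply, F.t_mor, G.t_mor, G.t_θ]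
        exact h
      θ_bracket := fun x y => by
        simp only [Hom.comp, Hom.id, hom, preHom, LinearMap.mk₂_apply, LinearMap.compr₂_apply,
          TwoVectorSpace.compose_eq, map_add, map_sub, mor_mor_connecting,
          t_connecting, F.t_F₂, L.bracket.t_mor, L.t_i, G.t_θ,
          PreLieTwoAlgebra.brM, PreLieTwoAlgebra.br]
        simp only [connecting_apply, PreLieTwoAlgebra.brM, PreLieTwoAlgebra.br]
        abel }
  exact ⟨F, G.hom, α, β, α.isInvertible, β.isInvertible⟩

end Retraction
end LieTwoAlgebra

/-! ### Equivalence of skeletal Lie 2-algebras -/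

namespace LieTwoAlgebra

open LieModule.Cohomology LieCohomology

theorem _root_.eq_zero_of_eq_neg {k M : Type*} [Field k] [AddCommGroup M] [Module k M]
    (hk : (2 : k) ≠ 0) {m : M} (h : m = -m) : m = 0 := by
  have h2 : (2 : k) • m = 0 := by
    rw [two_smul]
    nth_rw 1 [h]
    exact neg_add_cancel _
  exact (smul_eq_zero.1 h2).resolve_left hk

section Skeletal

variable {k : Type u} [Field k] {g g' : Type v} [LieRing g] [LieAlgebra k g]
  [LieRing g'] [LieAlgebra k g']
  {V V' : Type v} [AddCommGroup V] [Module k V] [AddCommGroup V'] [Module k V']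
  [LieRingModule g V] [LieModule k g V] [LieRingModule g' V'] [LieModule k g' V']

/-- The homomorphism of skeletal Lie 2-algebras given by an isomorphism of representations and a
2-cochain `a` whose coboundary is the difference of the two cocycles. -/
def skeletalHom {ω : threeCocycle k g V} {ω' : threeCocycle k g' V'} (φ : g ≃ₗ⁅k⁆ g')
    (ψ : V ≃ₗ[k] V') (h : ∀ (x : g) (v : V), ψ ⁅x, v⁆ = ⁅φ x, ψ v⁆) (a : twoCochain k g' V')
    (e : d₂₃ k g' V' a = transport φ ψ ω.1 - ω'.1) : Hom (ofCocycle ω) (ofCocycle ω') where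
  obj := (φ : g →ₗ[k] g')
  mor := ((φ : g →ₗ[k] g').prodMap (ψ : V →ₗ[k] V') : g × V →ₗ[k] g' × V')
  s_mor _ := rfl
  t_mor _ := rfl
  mor_i := fun (x : g) => by
    change ((φ x, ψ 0) : g' × V') = (φ x, 0)
    rw [map_zero]
  mor_comp := fun (f f' : g × V) _ => by
    change ((φ f.1, ψ (f.2 + f'.2)) : g' × V') = (φ f.1, ψ f.2 + ψ f'.2)
    rw [map_add]
  F₂ := (LinearMap.mk₂ k (fun x y => (⁅φ x, φ y⁆, a (φ x) (φ y)))
    (fun _ _ _ => by simp) (fun _ _ _ => by simp) (fun _ _ _ => by simp) (fun _ _ _ => by simp) :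
      g →ₗ[k] g →ₗ[k] g' × V')
  s_F₂ _ _ := rfl
  t_F₂ := fun (x y : g) => (φ.map_lie x y).symm
  F₂_natural := fun (f f' : g × V) => by
    change ((⁅φ f.1, φ f'.1⁆, ⁅φ f.1, ψ f'.2⁆ - ⁅φ f'.1, ψ f.2⁆ + a (φ f.1) (φ f'.1)) : g' × V') =
      (⁅φ f.1, φ f'.1⁆, a (φ f.1) (φ f'.1) + ψ (⁅f.1, f'.2⁆ - ⁅f'.1, f.2⁆))
    rw [map_sub, h, h, add_comm]
  F₂_skew := fun (x y : g) => by
    change ((⁅φ x, φ y⁆, a (φ x) (φ y)) : g' × V') = -(⁅φ y, φ x⁆, a (φ y) (φ x))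
    rw [← lie_skew, ← twoCochain_skew a (φ y)]
    rfl
  coherence := fun (x y z : g) => by
    have e' := LinearMap.congr_fun (LinearMap.congr_fun (LinearMap.congr_fun e (φ x)) (φ y)) (φ z)
    simp only [d₂₃_apply, LinearMap.sub_apply, transport_apply, LieEquiv.symm_apply_apply] at e'
    change ((⁅⁅φ x, φ y⁆, φ z⁆, ⁅⁅φ x, φ y⁆, (0 : V')⁆ - ⁅φ z, a (φ x) (φ y)⁆ + a (φ ⁅x, y⁆) (φ z) +
        ψ (ω.1 x y z)) : g' × V') =
      (⁅⁅φ x, φ y⁆, φ z⁆, ω'.1 (φ x) (φ y) (φ z) +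
        ((⁅φ x, a (φ y) (φ z)⁆ - ⁅⁅φ y, φ z⁆, (0 : V')⁆) +
          (⁅⁅φ x, φ z⁆, (0 : V')⁆ - ⁅φ y, a (φ x) (φ z)⁆)) +
        (a (φ x) (φ ⁅y, z⁆) + a (φ ⁅x, z⁆) (φ y)))
    refine congrArg (Prod.mk _) ?_
    rw [← twoCochain_skew a (φ ⁅y, z⁆) (φ x)]
    simp only [LieEquiv.map_lie, lie_zero]
    linear_combination (norm := abel) -e'

/-- The retraction of `skeletalHom` onto its inverse. -/
def skeletalRetraction {ω : threeCocycle k g V} {ω' : threeCocycle k g' V'} (φ : g ≃ₗ⁅k⁆ g')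
    (ψ : V ≃ₗ[k] V') (h : ∀ (x : g) (v : V), ψ ⁅x, v⁆ = ⁅φ x, ψ v⁆) (a : twoCochain k g' V')
    (e : d₂₃ k g' V' a = transport φ ψ ω.1 - ω'.1) :
    Retraction (skeletalHom φ ψ h a e) where
  obj := (φ.symm : g' →ₗ[k] g)
  mor := ((φ.symm : g' →ₗ[k] g).prodMap (ψ.symm : V' →ₗ[k] V) : g' × V' →ₗ[k] g × V)
  s_mor _ := rfl
  t_mor _ := rfl
  mor_i := fun (x : g') => by
    change ((φ.symm x, ψ.symm 0) : g × V) = (φ.symm x, 0)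
    rw [map_zero]
  mor_comp := fun (f f' : g' × V') _ => by
    change ((φ.symm f.1, ψ.symm (f.2 + f'.2)) : g × V) = (φ.symm f.1, ψ.symm f.2 + ψ.symm f'.2)
    rw [map_add]
  obj_obj := φ.symm_apply_apply
  mor_mor := fun (f : g × V) =>
    Prod.ext (φ.symm_apply_apply f.1) (ψ.symm_apply_apply f.2)
  θ := LinearMap.inl k g' V'
  s_θ := fun (x : g') => (φ.apply_symm_apply x).symm
  t_θ _ := rfl
  θ_natural := fun (f : g' × V') => by
    have e' : ((φ (φ.symm f.1), ψ (ψ.symm f.2)) : g' × V') + (f.1, 0) - (φ (φ.symm f.1), 0) =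
        (f.1, 0) + f - (f.1, 0) := by
      rw [LieEquiv.apply_symm_apply, LinearEquiv.apply_symm_apply]
      abel
    exact e'
  θ_obj _ := rfl

/-- Equality of classes provides a 2-cochain `a` whose coboundary is the difference of the cocycles;
it serves as the `V'`-part of `F₂`. -/
theorem equivalent_of_isomorphic {ω : threeCocycle k g V} {ω' : threeCocycle k g' V'}
    (H : LieQuadruple.Isomorphic ⟨g, V, H3.mk ω⟩ ⟨g', V', H3.mk ω'⟩) :
    Equivalent (ofCocycle ω) (ofCocycle ω') := by
  obtain ⟨φ, ψ, h, e⟩ := H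
  have e' := (Submodule.Quotient.eq _).1 e
  obtain ⟨a, ha⟩ := e'
  exact (skeletalRetraction φ ψ h a ha).equivalent

/-- Skeletality turns the existence of a morphism between two objects into their equality, and
composition is addition in `V`, so natural transformations cancel out of their naturality squares.
-/
theorem isomorphic_of_equivalent (hk : (2 : k) ≠ 0) {ω : threeCocycle k g V}
    {ω' : threeCocycle k g' V'} (H : Equivalent (ofCocycle ω) (ofCocycle ω')) :
    LieQuadruple.Isomorphic ⟨g, V, H3.mk ω⟩ ⟨g', V', H3.mk ω'⟩ := by
  obtain ⟨F, G, α, β, -, -⟩ := H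
  let f₀ : g →ₗ[k] g' := F.obj
  let g₀ : g' →ₗ[k] g := G.obj
  let f₁ : g × V →ₗ[k] g' × V' := F.mor
  let g₁ : g' × V' →ₗ[k] g × V := G.mor
  let f₂ : g →ₗ[k] g →ₗ[k] g' × V' := F.F₂
  have gf₀ : ∀ x, g₀ (f₀ x) = x := fun x => (α.s_θ x).symm.trans (α.t_θ x)
  have fg₀ : ∀ x, f₀ (g₀ x) = x := fun x => (β.s_θ x).symm.trans (β.t_θ x)
  have f₁₁ : ∀ m, (f₁ m).1 = f₀ m.1 := F.s_mor
  have g₁₁ : ∀ m, (g₁ m).1 = g₀ m.1 := G.s_mor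
  -- The `V`-components of `α` at the source and the target of `m` are the same vector, since these
  -- objects coincide.
  have gf₁ : ∀ m, (g₁ (f₁ m)).2 = m.2 := fun m => by
    have h := congrArg Prod.snd (α.θ_natural m)
    change (g₁ (f₁ m)).2 + _ = _ + m.2 at h
    rw [add_comm] at h
    exact add_left_cancel h
  have fg₁ : ∀ m, (f₁ (g₁ m)).2 = m.2 := fun m => by
    have h := congrArg Prod.snd (β.θ_natural m)
    change (f₁ (g₁ m)).2 + _ = _ + m.2 at h
    rw [add_comm] at h
    exact add_left_cancel h
  have flie : ∀ x y, f₀ ⁅x, y⁆ = ⁅f₀ x, f₀ y⁆ := fun x y => (F.t_F₂ x y).symm.trans (F.s_F₂ x y)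
  have f₁i : ∀ x, f₁ (x, 0) = (f₀ x, 0) := F.mor_i
  have f₁v : ∀ v, f₁ (0, v) = (0, (f₁ (0, v)).2) := fun v => Prod.ext (by simp [f₁₁]) rfl
  have g₁v : ∀ v, g₁ (0, v) = (0, (g₁ (0, v)).2) := fun v => Prod.ext (by simp [g₁₁]) rfl
  let φ : g ≃ₗ⁅k⁆ g' :=
    { toLinearMap := f₀, map_lie' := flie _ _, invFun := g₀, left_inv := gf₀, right_inv := fg₀ }
  let ψ : V ≃ₗ[k] V' :=
    { toLinearMap := LinearMap.snd k g' V' ∘ₗ f₁ ∘ₗ LinearMap.inr k g V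
      invFun := LinearMap.snd k g V ∘ₗ g₁ ∘ₗ LinearMap.inr k g' V'
      left_inv := fun v => by
        change (g₁ (0, (f₁ (0, v)).2)).2 = v
        rw [← f₁v, gf₁]
      right_inv := fun v => by
        change (f₁ (0, (g₁ (0, v)).2)).2 = v
        rw [← g₁v, fg₁] }
  have hψ : ∀ m, (f₁ m).2 = ψ m.2 := fun m => by
    have : m = (m.1, 0) + (0, m.2) := by simp
    rw [this, map_add, f₁i]
    change 0 + (f₁ (0, m.2)).2 = (f₁ (0, 0 + m.2)).2
    simp
  -- Naturality of `F₂` at the identity of `x` and the automorphism `v` of `0`: `F₂ x 0` vanishes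
  -- and equivariance of `ψ` remains.
  have h : ∀ (x : g) (v : V), ψ ⁅x, v⁆ = ⁅φ x, ψ v⁆ := fun x v => by
    have h := congrArg Prod.snd (F.F₂_natural (x, 0) (0, v))
    change (⁅(f₁ (x, 0)).1, (f₁ (0, v)).2⁆ - ⁅(f₁ (0, v)).1, (f₁ (x, 0)).2⁆) + (f₂ x 0).2 =
      (f₂ x 0).2 + (f₁ (⁅x, 0⁆, ⁅x, v⁆ - ⁅(0 : g), (0 : V)⁆)).2 at h
    rw [f₁i, f₁v] at h
    simp only [hψ, map_zero, lie_zero, sub_zero, Prod.snd_zero, add_zero, zero_add] at h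
    exact h.symm
  have skew : ∀ x y, (f₂ x y).2 = -(f₂ y x).2 := fun x y => congrArg Prod.snd (F.F₂_skew x y)
  let a : twoCochain k g' V' :=
    ⟨(f₂.compl₁₂ g₀ g₀).compr₂ (LinearMap.snd k g' V'),
      fun x => eq_zero_of_eq_neg hk (skew (g₀ x) (g₀ x))⟩
  have ha : ∀ x y, a x y = (f₂ (g₀ x) (g₀ y)).2 := fun _ _ => rfl
  refine ⟨φ, ψ, h, (Submodule.Quotient.eq _).2 ⟨a, ?_⟩⟩
  ext x y z
  change d₂₃ k g' V' a x y z = ψ (ω.1 (g₀ x) (g₀ y) (g₀ z)) - ω'.1 x y z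
  obtain ⟨x, rfl⟩ := Function.RightInverse.surjective fg₀ x
  obtain ⟨y, rfl⟩ := Function.RightInverse.surjective fg₀ y
  obtain ⟨z, rfl⟩ := Function.RightInverse.surjective fg₀ z
  -- The `V'`-component of coherence is the coboundary equation, up to the order of arguments in one
  -- term.
  have hc := congrArg Prod.snd (F.coherence x y z)
  change (⁅(f₂ x y).1, (0 : V')⁆ - ⁅f₀ z, (f₂ x y).2⁆) + (f₂ ⁅x, y⁆ z).2 +
      (f₁ (⁅⁅x, y⁆, z⁆, ω.1 x y z)).2 =
    ω'.1 (f₀ x) (f₀ y) (f₀ z) + ((⁅f₀ x, (f₂ y z).2⁆ - ⁅(f₂ y z).1, (0 : V')⁆) +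
        (⁅(f₂ x z).1, (0 : V')⁆ - ⁅f₀ y, (f₂ x z).2⁆)) +
      ((f₂ x ⁅y, z⁆).2 + (f₂ ⁅x, z⁆ y).2) at hc
  simp only [hψ, lie_zero] at hc
  rw [skew x ⁅y, z⁆] at hc
  simp only [d₂₃_apply, ha, ← flie, gf₀]
  linear_combination (norm := abel) -hc

end Skeletal
end LieTwoAlgebra

/-! ### The bracket and Jacobiator as operations on a two-term complex -/

namespace LieTwoAlgebra

open LieModule.Cohomology LieCohomology

section Action

variable {k : Type u} [Field k] (L : LieTwoAlgebra.{u, v} k)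

/-- The action of objects on morphisms, `[1ₓ, f]`. -/
def act : L.Ob →ₗ[k] L.Mor →ₗ[k] L.Mor := L.bracket.mor ∘ₗ L.i

/-- The arrow part of the Jacobiator. -/
def arrowJ (x y z : L.Ob) : L.Mor := L.arrow (L.J x y z)

theorem act_apply (x : L.Ob) (f : L.Mor) : L.act x f = L.bracket.mor (L.i x) f := rfl

theorem mor_i_right (x : L.Ob) (f : L.Mor) : L.bracket.mor f (L.i x) = -L.act x f :=
  L.bracket_skew.mor _ _

theorem s_act (x : L.Ob) (f : L.Mor) : L.s (L.act x f) = L.br x (L.s f) := by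
  rw [act_apply, L.bracket.s_mor, L.s_i]

theorem t_act (x : L.Ob) (f : L.Mor) : L.t (L.act x f) = L.br x (L.t f) := by
  rw [act_apply, L.bracket.t_mor, L.t_i]

theorem act_i (x y : L.Ob) : L.act x (L.i y) = L.i (L.br x y) := L.bracket.mor_i x y

theorem arrowJ_eq (x y z : L.Ob) : L.arrowJ x y z = L.J x y z - L.i (L.br (L.br x y) z) := by
  rw [arrowJ, TwoVectorSpace.arrow, L.s_J]

theorem s_arrowJ (x y z : L.Ob) : L.s (L.arrowJ x y z) = 0 := by
  rw [arrowJ, TwoVectorSpace.arrow, map_sub, L.s_i, sub_self]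

theorem t_arrowJ (x y z : L.Ob) : L.t (L.arrowJ x y z) =
    L.br x (L.br y z) + L.br (L.br x z) y - L.br (L.br x y) z := by
  rw [arrowJ_eq, map_sub, L.t_i, L.t_J]

theorem arrowJ_swap₁₂ (x y z : L.Ob) : L.arrowJ y x z = -L.arrowJ x y z := L.J_swap₁₂ x y z

theorem arrowJ_swap₂₃ (x y z : L.Ob) : L.arrowJ x z y = -L.arrowJ x y z := L.J_swap₂₃ x y z

theorem arrowJ_sub_left (x x' y z : L.Ob) :
    L.arrowJ (x - x') y z = L.arrowJ x y z - L.arrowJ x' y z := by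
  simp only [arrowJ_eq, PreLieTwoAlgebra.br, map_sub, LinearMap.sub_apply]
  abel

/-- Functoriality for `f = f 1` and `g = 1₀ g`: the first factor `[f, 1₀]` is zero. -/
theorem mor_eq_act (f : L.Mor) {g : L.Mor} (hg : L.s g = 0) :
    L.bracket.mor f g = L.act (L.t f) g := by
  have h := L.bracket.mor_add f (L.i (L.t f)) 0 g (by simp) (by simp [hg])
  simpa [act_apply] using h

/-- By `mor_eq_act` both sides compute `[f, g]`, one of them after skew-symmetry. -/
theorem act_t_comm {f g : L.Mor} (hf : L.s f = 0) (hg : L.s g = 0) :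
    L.act (L.t f) g = -L.act (L.t g) f := by
  rw [← L.mor_eq_act f hg, ← L.mor_eq_act g hf]
  exact L.bracket_skew.mor f g

/-- Naturality of `J` in its last variable along `f : 0 → t f`, where the component at `0` is zero.
-/
theorem arrowJ_t (x y : L.Ob) {f : L.Mor} (hf : L.s f = 0) : L.arrowJ x y (L.t f) =
    L.act x (L.act y f) - L.act y (L.act x f) - L.act (L.br x y) f := by
  have h := L.J_natural (L.i x) (L.i y) f
  have e : L.bracket.mor (L.bracket.mor (L.i x) f) (L.i y) = -L.act y (L.act x f) :=
    L.mor_i_right _ _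
  simp only [TwoVectorSpace.compose_eq, L.bracket.mor_i, L.bracket.t_mor, L.t_i, L.s_i, hf,
    map_zero, e, zero_add, sub_zero] at h
  simp only [arrowJ_eq, act_apply, PreLieTwoAlgebra.br] at h ⊢
  linear_combination (norm := abel) h

/-- The Jacobiator identity after subtracting identity morphisms: both composites become sums of
arrow parts. -/
theorem arrowJ_jacobi (w x y z : L.Ob) :
    L.act w (L.arrowJ x y z) - L.act x (L.arrowJ w y z) + L.act y (L.arrowJ w x z) -
      L.act z (L.arrowJ w x y) - L.arrowJ (L.br w x) y z + L.arrowJ (L.br w y) x z -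
      L.arrowJ (L.br w z) x y - L.arrowJ (L.br x y) w z + L.arrowJ (L.br x z) w y -
      L.arrowJ (L.br y z) w x = 0 := by
  have h := L.jacobiator_identity w x y z
  have hJ : ∀ a b c, L.J a b c = L.arrowJ a b c + L.i (L.br (L.br a b) c) := fun a b c => by
    rw [arrowJ_eq]; abel
  simp only [PreLieTwoAlgebra.brM, PreLieTwoAlgebra.br] at h
  simp only [TwoVectorSpace.compose_eq, map_add, L.t_i,
    LinearMap.add_apply, mor_i_right, hJ, act_i, ← act_apply, PreLieTwoAlgebra.br,
    L.t_arrowJ, map_sub, map_neg, L.t_act, L.bracket_skew.obj w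
      (L.bracket.obj (L.bracket.obj x y) z)] at h
  rw [L.arrowJ_swap₁₂ (L.bracket.obj x z) w y, L.arrowJ_swap₁₂ (L.bracket.obj x y) w z,
    L.arrowJ_swap₂₃ w (L.bracket.obj y z) x, L.arrowJ_swap₁₂ (L.bracket.obj y z) w x] at h
  -- The leftover identity morphisms cancel only after using skew-symmetry of the bracket on
  -- objects.
  have K : ∀ a b c, L.i (L.bracket.obj (L.bracket.obj a b) c) +
      L.i (L.bracket.obj c (L.bracket.obj a b)) = 0 := fun a b c => by
    rw [← map_add, L.bracket_skew.obj c, add_neg_cancel, map_zero]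
  simp only [PreLieTwoAlgebra.br]
  linear_combination (norm := abel) -h + K (L.bracket.obj w x) y z - K (L.bracket.obj w x) z y +
    K w (L.bracket.obj x z) y + K (L.bracket.obj w z) x y - K (L.bracket.obj w y) x z -
    K w (L.bracket.obj x y) z + K (L.bracket.obj w y) z x - K (L.bracket.obj w z) y x -
    K w (L.bracket.obj y z) x

end Action

/-! ### Homotopy transfer of the Jacobiator -/

/-- A splitting of the underlying 2-vector space of `L`: the space `g` of isomorphism classes of
objects and the space `V` of automorphisms of `0`, with the operations induced by the bracket,
together with a deformation retraction onto the skeleton. -/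
structure Splitting {k : Type u} [Field k] (L : LieTwoAlgebra.{u, v} k) (g V : Type v) [LieRing g]
    [LieAlgebra k g] [AddCommGroup V] [Module k V] [LieRingModule g V] [LieModule k g V] where
  p : L.Ob →ₗ[k] g
  σ : g →ₗ[k] L.Ob
  h : L.Ob →ₗ[k] L.Mor
  ι : V →ₗ[k] L.Mor
  q : L.Mor →ₗ[k] V
  p_σ : ∀ x, p (σ x) = x
  p_t : ∀ f, p (L.t f) = p (L.s f)
  s_h : ∀ x, L.s (h x) = 0
  t_h : ∀ x, L.t (h x) = x - σ (p x)
  h_σ : ∀ x, h (σ x) = 0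
  ι_injective : Function.Injective ι
  s_ι : ∀ v, L.s (ι v) = 0
  t_ι : ∀ v, L.t (ι v) = 0
  ι_q : ∀ f, ι (q f) = f - L.i (L.s f) - h (L.t f - L.s f)
  lie : ∀ x y, ⁅x, y⁆ = p (L.br (σ x) (σ y))
  ι_lie : ∀ x v, ι ⁅x, v⁆ = L.act (σ x) (ι v)

namespace Splitting

variable {k : Type u} [Field k] {L : LieTwoAlgebra.{u, v} k} {g V : Type v} [LieRing g]
  [LieAlgebra k g] [AddCommGroup V] [Module k V] [LieRingModule g V] [LieModule k g V]

/-- The morphism part of the failure of `σ` to preserve brackets. -/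
def defect (S : Splitting L g V) : g →ₗ[k] g →ₗ[k] L.Mor :=
  (L.bracket.obj.compl₁₂ S.σ S.σ).compr₂ S.h

theorem defect_apply (S : Splitting L g V) (x y : g) :
    S.defect x y = S.h (L.br (S.σ x) (S.σ y)) := rfl

theorem s_defect (S : Splitting L g V) (x y : g) : L.s (S.defect x y) = 0 := S.s_h _

theorem t_defect (S : Splitting L g V) (x y : g) :
    L.t (S.defect x y) = L.br (S.σ x) (S.σ y) - S.σ ⁅x, y⁆ := by
  rw [defect_apply, S.t_h, S.lie]

theorem defect_skew (S : Splitting L g V) (x y : g) : S.defect x y = -S.defect y x := by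
  rw [defect_apply, defect_apply, PreLieTwoAlgebra.br, L.bracket_skew.obj, map_neg]

theorem σ_lie (S : Splitting L g V) (x y : g) :
    S.σ ⁅x, y⁆ = L.br (S.σ x) (S.σ y) - L.t (S.defect x y) := by
  rw [t_defect]; abel

/-- The transferred Jacobiator, as a morphism of `L`. -/
def transferred (S : Splitting L g V) (x y z : g) : L.Mor :=
  L.arrowJ (S.σ x) (S.σ y) (S.σ z) - L.act (S.σ x) (S.defect y z) + L.act (S.σ y) (S.defect x z) -
    L.act (S.σ z) (S.defect x y) - S.defect x ⁅y, z⁆ - S.defect ⁅x, z⁆ y + S.defect ⁅x, y⁆ z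

theorem s_transferred (S : Splitting L g V) (x y z : g) : L.s (S.transferred x y z) = 0 := by
  simp [transferred, s_arrowJ, s_act, s_defect]

/-- The defect terms replace each bracket of lifts by the lift of a bracket, so the target becomes
`σ` of the Jacobi expression in `g`, which is zero. -/
theorem t_transferred (S : Splitting L g V) (x y z : g) : L.t (S.transferred x y z) = 0 := by
  have e : S.σ ⁅x, ⁅y, z⁆⁆ + S.σ ⁅⁅x, z⁆, y⁆ - S.σ ⁅⁅x, y⁆, z⁆ = 0 := by
    rw [← map_add, ← map_sub, leibniz_left x y z, sub_self, map_zero]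
  have k1 := L.bracket_skew.obj (S.σ y) (L.bracket.obj (S.σ x) (S.σ z) - S.σ ⁅x, z⁆)
  have k2 := L.bracket_skew.obj (S.σ z) (L.bracket.obj (S.σ x) (S.σ y) - S.σ ⁅x, y⁆)
  simp only [transferred, map_add, map_sub, t_arrowJ, t_act, t_defect, PreLieTwoAlgebra.br,
    LinearMap.sub_apply] at k1 k2 ⊢
  linear_combination (norm := abel) e + k1 - k2

theorem ι_q_transferred (S : Splitting L g V) (x y z : g) :
    S.ι (S.q (S.transferred x y z)) = S.transferred x y z := by
  simp [S.ι_q, s_transferred, t_transferred]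

/-- The transferred Jacobiator as a 3-cochain. -/
def cochain (S : Splitting L g V) : g →ₗ[k] g →ₗ[k] g →ₗ[k] V where
  toFun x := LinearMap.mk₂ k (fun y z => S.q (S.transferred x y z))
    (fun y y' z => by
      rw [← map_add]; congr 1
      simp [transferred, arrowJ_eq, PreLieTwoAlgebra.br]; abel)
    (fun c y z => by
      rw [← map_smul]; congr 1
      simp [transferred, arrowJ_eq, PreLieTwoAlgebra.br, smul_sub])
    (fun y z z' => by
      rw [← map_add]; congr 1
      simp [transferred, arrowJ_eq, PreLieTwoAlgebra.br]; abel)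
    (fun c y z => by
      rw [← map_smul]; congr 1
      simp [transferred, arrowJ_eq, PreLieTwoAlgebra.br, smul_sub])
  map_add' x x' := by
    ext y z
    simp only [LinearMap.mk₂_apply, LinearMap.add_apply]
    rw [← map_add]; congr 1
    simp [transferred, arrowJ_eq, PreLieTwoAlgebra.br]; abel
  map_smul' c x := by
    ext y z
    simp only [LinearMap.mk₂_apply, LinearMap.smul_apply, RingHom.id_apply]
    rw [← map_smul]; congr 1
    simp [transferred, arrowJ_eq, PreLieTwoAlgebra.br, smul_sub]

theorem ι_cochain (S : Splitting L g V) (x y z : g) :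
    S.ι (S.cochain x y z) = S.transferred x y z := S.ι_q_transferred x y z

theorem transferred_swap₁₂ (S : Splitting L g V) (x y z : g) :
    S.transferred y x z = -S.transferred x y z := by
  have h1 := S.defect_skew x ⁅y, z⁆
  have h2 := S.defect_skew y ⁅x, z⁆
  have h3 : S.defect ⁅x, y⁆ z = -S.defect ⁅y, x⁆ z := by rw [← lie_skew, map_neg]; rfl
  simp only [transferred, L.arrowJ_swap₁₂ (S.σ x), S.defect_skew y x, map_neg]
  linear_combination (norm := abel) -h1 - h2 + h3

theorem transferred_swap₂₃ (S : Splitting L g V) (x y z : g) :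
    S.transferred x z y = -S.transferred x y z := by
  have h3 : S.defect x ⁅y, z⁆ = -S.defect x ⁅z, y⁆ := by rw [← lie_skew, map_neg]
  simp only [transferred, L.arrowJ_swap₂₃ (S.σ x) (S.σ y), S.defect_skew z y, map_neg]
  linear_combination (norm := abel) -h3

/-- Here `σ ⁅w, x⁆` is `[σ w, σ x]` minus a boundary, and `arrowJ_t` turns the Jacobiator of that
boundary into iterated actions. In this form the terms of the cocycle equation can be matched. -/
theorem transferred_lie (S : Splitting L g V) (w x y z : g) : S.transferred ⁅w, x⁆ y z =
    L.arrowJ (L.br (S.σ w) (S.σ x)) (S.σ y) (S.σ z) -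
      (L.act (S.σ y) (L.act (S.σ z) (S.defect w x)) - L.act (S.σ z) (L.act (S.σ y) (S.defect w x)) -
        L.act (L.br (S.σ y) (S.σ z)) (S.defect w x)) -
      L.act (L.br (S.σ w) (S.σ x)) (S.defect y z) + L.act (L.t (S.defect w x)) (S.defect y z) +
      L.act (S.σ y) (S.defect ⁅w, x⁆ z) - L.act (S.σ z) (S.defect ⁅w, x⁆ y) -
      S.defect ⁅w, x⁆ ⁅y, z⁆ - S.defect ⁅⁅w, x⁆, z⁆ y + S.defect ⁅⁅w, x⁆, y⁆ z := by
  rw [← L.arrowJ_t _ _ (S.s_defect w x), L.arrowJ_swap₂₃ (S.σ y) (L.t (S.defect w x)),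
    L.arrowJ_swap₁₂ (L.t (S.defect w x)), transferred, σ_lie, arrowJ_sub_left, map_sub,
    LinearMap.sub_apply]
  abel

/-- The Jacobiator terms cancel by `arrowJ_jacobi`, and the iterated actions cancel against those of
`transferred_lie`. Defects acting on defects cancel in pairs by `act_t_comm`, and defects of
iterated brackets by the Jacobi identity in `g`. -/
theorem transferred_cocycle (S : Splitting L g V) (w x y z : g) :
    L.act (S.σ w) (S.transferred x y z) - L.act (S.σ x) (S.transferred w y z) +
      L.act (S.σ y) (S.transferred w x z) - L.act (S.σ z) (S.transferred w x y) -
      S.transferred ⁅w, x⁆ y z + S.transferred ⁅w, y⁆ x z - S.transferred ⁅w, z⁆ x y -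
      S.transferred ⁅x, y⁆ w z + S.transferred ⁅x, z⁆ w y - S.transferred ⁅y, z⁆ w x = 0 := by
  have hJ := L.arrowJ_jacobi (S.σ w) (S.σ x) (S.σ y) (S.σ z)
  have jac : ∀ a b c d, S.defect ⁅⁅a, b⁆, c⁆ d - S.defect ⁅⁅a, c⁆, b⁆ d + S.defect ⁅⁅b, c⁆, a⁆ d =
      0 := fun a b c d => by
    have e := congrArg (fun t => S.defect t d) (leibniz_left a b c)
    have e' : S.defect ⁅a, ⁅b, c⁆⁆ d = -S.defect ⁅⁅b, c⁆, a⁆ d := by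
      rw [← lie_skew, map_neg]; rfl
    simp only [map_add, LinearMap.add_apply] at e
    linear_combination (norm := abel) e + e'
  have p1 := L.act_t_comm (S.s_defect w x) (S.s_defect y z)
  have p2 := L.act_t_comm (S.s_defect w y) (S.s_defect x z)
  have p3 := L.act_t_comm (S.s_defect w z) (S.s_defect x y)
  have b1 := S.defect_skew ⁅w, x⁆ ⁅y, z⁆
  have b2 := S.defect_skew ⁅w, y⁆ ⁅x, z⁆
  have b3 := S.defect_skew ⁅w, z⁆ ⁅x, y⁆
  simp only [transferred_lie]
  simp only [transferred, map_add, map_sub, S.defect_skew w ⁅_, _⁆, S.defect_skew x ⁅_, _⁆, map_neg]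
  linear_combination (norm := abel) hJ - p1 + p2 - p3 + b1 - b2 + b3 -
    jac w x y z + jac w x z y - jac w y z x + jac x y z w

end Splitting
end LieTwoAlgebra

/-! ### The skeleton as a deformation retract -/

namespace LieTwoAlgebra

open LieModule.Cohomology LieCohomology

namespace Splitting

variable {k : Type u} [Field k] {L : LieTwoAlgebra.{u, v} k} {g V : Type v} [LieRing g]
  [LieAlgebra k g] [AddCommGroup V] [Module k V] [LieRingModule g V] [LieModule k g V]

/-- The transferred Jacobiator as a 3-cocycle. -/
def cocycle (S : Splitting L g V) (hk : (2 : k) ≠ 0) : threeCocycle k g V :=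
  ⟨S.cochain, fun x y => eq_zero_of_eq_neg hk <| S.ι_injective <| by
      rw [map_neg, ι_cochain, ← transferred_swap₁₂],
    fun x y => eq_zero_of_eq_neg hk <| S.ι_injective <| by
      rw [map_neg, ι_cochain, ← transferred_swap₂₃],
    fun w x y z => S.ι_injective <| by
      simpa only [map_add, map_sub, S.ι_lie, ι_cochain, map_zero] using
        S.transferred_cocycle w x y z⟩

/-- The bracket of two automorphisms of `0` is zero by `mor_eq_act`, so only the action terms
survive, as in the skeletal bracket. -/
theorem mor_eq (S : Splitting L g V) (f f' : g × V) :
    L.bracket.mor (L.i (S.σ f.1) + S.ι f.2) (L.i (S.σ f'.1) + S.ι f'.2) =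
      L.i (L.br (S.σ f.1) (S.σ f'.1)) + S.ι (⁅f.1, f'.2⁆ - ⁅f'.1, f.2⁆) := by
  have h := L.mor_eq_act (S.ι f.2) (S.s_ι f'.2)
  rw [S.t_ι, map_zero, LinearMap.zero_apply] at h
  simp only [map_add, LinearMap.add_apply, L.bracket.mor_i, mor_i_right, ← act_apply, h, map_sub,
    S.ι_lie]
  abel

/-- The inclusion of the skeleton. -/
def hom (S : Splitting L g V) (hk : (2 : k) ≠ 0) : Hom (ofCocycle (S.cocycle hk)) L where
  obj := S.σ
  mor := ((L.i ∘ₗ S.σ).coprod S.ι : g × V →ₗ[k] L.Mor)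
  s_mor := fun (f : g × V) => by
    change L.s (L.i (S.σ f.1) + S.ι f.2) = S.σ f.1
    rw [map_add, L.s_i, S.s_ι, add_zero]
  t_mor := fun (f : g × V) => by
    change L.t (L.i (S.σ f.1) + S.ι f.2) = S.σ f.1
    rw [map_add, L.t_i, S.t_ι, add_zero]
  mor_i := fun (x : g) => by
    change L.i (S.σ x) + S.ι 0 = L.i (S.σ x)
    rw [map_zero, add_zero]
  mor_comp := fun (f f' : g × V) (h : f.1 = f'.1) => by
    rw [TwoVectorSpace.compose_eq]
    change L.i (S.σ f.1) + S.ι (f.2 + f'.2) = L.i (S.σ f.1) + S.ι f.2 +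
      (L.i (S.σ f'.1) + S.ι f'.2) - L.i (L.t (L.i (S.σ f.1) + S.ι f.2))
    rw [map_add L.t, L.t_i, S.t_ι, h, map_add]
    abel_nf
  F₂ := (L.bracket.obj.compl₁₂ S.σ S.σ).compr₂ L.i - S.defect
  s_F₂ := fun (x y : g) => by
    change L.s (L.i (L.br (S.σ x) (S.σ y)) - S.defect x y) = L.br (S.σ x) (S.σ y)
    rw [map_sub, L.s_i, S.s_defect, sub_zero]
  t_F₂ := fun (x y : g) => by
    change L.t (L.i (L.br (S.σ x) (S.σ y)) - S.defect x y) = S.σ ⁅x, y⁆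
    rw [map_sub, L.t_i, S.t_defect]
    abel
  F₂_natural := fun (f f' : g × V) => by
    rw [TwoVectorSpace.compose_eq, TwoVectorSpace.compose_eq]
    change L.bracket.mor (L.i (S.σ f.1) + S.ι f.2) (L.i (S.σ f'.1) + S.ι f'.2) +
        (L.i (L.br (S.σ f.1) (S.σ f'.1)) - S.defect f.1 f'.1) -
        L.i (L.t (L.bracket.mor (L.i (S.σ f.1) + S.ι f.2) (L.i (S.σ f'.1) + S.ι f'.2))) =
      L.i (L.br (S.σ f.1) (S.σ f'.1)) - S.defect f.1 f'.1 +
        (L.i (S.σ ⁅f.1, f'.1⁆) + S.ι (⁅f.1, f'.2⁆ - ⁅f'.1, f.2⁆)) -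
        L.i (L.t (L.i (L.br (S.σ f.1) (S.σ f'.1)) - S.defect f.1 f'.1))
    rw [mor_eq, map_add L.t, map_sub L.t, L.t_i, S.t_ι, S.t_defect]
    simp only [map_sub, add_zero]
    abel
  F₂_skew := fun (x y : g) => by
    change L.i (L.br (S.σ x) (S.σ y)) - S.defect x y = -(L.i (L.br (S.σ y) (S.σ x)) - S.defect y x)
    rw [S.defect_skew x y, PreLieTwoAlgebra.br, L.bracket_skew.obj, map_neg]
    abel
  coherence := fun (x y z : g) => by
    simp only [TwoVectorSpace.compose_eq]
    change L.bracket.mor (L.i (L.br (S.σ x) (S.σ y)) - S.defect x y) (L.i (S.σ z)) +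
          (L.i (L.br (S.σ ⁅x, y⁆) (S.σ z)) - S.defect ⁅x, y⁆ z) -
          L.i (L.t (L.bracket.mor (L.i (L.br (S.σ x) (S.σ y)) - S.defect x y) (L.i (S.σ z)))) +
        (L.i (S.σ ⁅⁅x, y⁆, z⁆) + S.ι (S.cochain x y z)) -
        L.i (L.t (L.bracket.mor (L.i (L.br (S.σ x) (S.σ y)) - S.defect x y) (L.i (S.σ z)) +
          (L.i (L.br (S.σ ⁅x, y⁆) (S.σ z)) - S.defect ⁅x, y⁆ z) -
          L.i (L.t (L.bracket.mor (L.i (L.br (S.σ x) (S.σ y)) - S.defect x y) (L.i (S.σ z)))))) =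
      L.J (S.σ x) (S.σ y) (S.σ z) +
          (L.bracket.mor (L.i (S.σ x)) (L.i (L.br (S.σ y) (S.σ z)) - S.defect y z) +
            L.bracket.mor (L.i (L.br (S.σ x) (S.σ z)) - S.defect x z) (L.i (S.σ y))) -
          L.i (L.t (L.J (S.σ x) (S.σ y) (S.σ z))) +
        (L.i (L.br (S.σ x) (S.σ ⁅y, z⁆)) - S.defect x ⁅y, z⁆ +
          (L.i (L.br (S.σ ⁅x, z⁆) (S.σ y)) - S.defect ⁅x, z⁆ y)) -
        L.i (L.t (L.J (S.σ x) (S.σ y) (S.σ z) +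
          (L.bracket.mor (L.i (S.σ x)) (L.i (L.br (S.σ y) (S.σ z)) - S.defect y z) +
            L.bracket.mor (L.i (L.br (S.σ x) (S.σ z)) - S.defect x z) (L.i (S.σ y))) -
          L.i (L.t (L.J (S.σ x) (S.σ y) (S.σ z)))))
    -- `transferred` is this equation solved for the image of the cochain; what is left is a
    -- cancellation of identity morphisms.
    rw [ι_cochain, transferred, arrowJ_eq]
    simp only [mor_i_right, ← act_apply, map_sub, map_add, map_neg, LinearMap.sub_apply, act_i,
      L.t_i, L.t_J, S.t_defect, L.t_act, PreLieTwoAlgebra.br]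
    have K : ∀ a c, L.i (L.bracket.obj a c) + L.i (L.bracket.obj c a) = 0 := fun a c => by
      rw [L.bracket_skew.obj c, map_neg, add_neg_cancel]
    linear_combination (norm := abel) K (S.σ ⁅x, y⁆) (S.σ z) - K (S.σ ⁅x, z⁆) (S.σ y) -
      K (S.σ z) (L.bracket.obj (S.σ x) (S.σ y)) + K (L.bracket.obj (S.σ x) (S.σ z)) (S.σ y)

/-- The retraction of `L` onto its skeleton. -/
def retraction (S : Splitting L g V) (hk : (2 : k) ≠ 0) : Retraction (S.hom hk) where
  obj := S.p
  mor := ((S.p ∘ₗ L.s).prod S.q : L.Mor →ₗ[k] g × V)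
  s_mor _ := rfl
  t_mor f := (S.p_t f).symm
  mor_i := fun x => by
    change ((S.p (L.s (L.i x)), S.q (L.i x)) : g × V) = (S.p x, 0)
    have h : S.q (L.i x) = 0 := S.ι_injective (by simp [S.ι_q])
    rw [h, L.s_i]
  mor_comp := fun f f' h => by
    change ((S.p (L.s (L.compose f f' h)), S.q (L.compose f f' h)) : g × V) =
      (S.p (L.s f), S.q f + S.q f')
    have e : S.q (L.compose f f' h) = S.q f + S.q f' := S.ι_injective (by
      simp only [map_add, S.ι_q, L.s_compose, L.t_compose, map_sub, h]
      rw [TwoVectorSpace.compose_eq, h]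
      abel)
    rw [e, L.s_compose]
  obj_obj := S.p_σ
  mor_mor := fun (f : g × V) => by
    change ((S.p (L.s (L.i (S.σ f.1) + S.ι f.2)), S.q (L.i (S.σ f.1) + S.ι f.2)) : g × V) = f
    have e : S.q (L.i (S.σ f.1) + S.ι f.2) = f.2 := S.ι_injective (by
      simp [S.ι_q, S.s_ι, S.t_ι])
    rw [e, map_add L.s, L.s_i, S.s_ι, add_zero, S.p_σ]
  θ := L.i ∘ₗ S.σ ∘ₗ S.p + S.h
  s_θ x := by
    change L.s (L.i (S.σ (S.p x)) + S.h x) = S.σ (S.p x)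
    rw [map_add, L.s_i, S.s_h, add_zero]
  t_θ x := by
    change L.t (L.i (S.σ (S.p x)) + S.h x) = x
    rw [map_add, L.t_i, S.t_h, add_sub_cancel]
  θ_natural f := by
    change (L.i (S.σ (S.p (L.s f))) + S.ι (S.q f)) + (L.i (S.σ (S.p (L.t f))) + S.h (L.t f)) -
      L.i (S.σ (S.p (L.t f))) = (L.i (S.σ (S.p (L.s f))) + S.h (L.s f)) + f - L.i (L.s f)
    rw [S.ι_q, map_sub]
    abel
  θ_obj := fun (x : g) => by
    change L.i (S.σ (S.p (S.σ x))) + S.h (S.σ x) = L.i (S.σ x)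
    rw [S.p_σ, S.h_σ, add_zero]

theorem equivalent (S : Splitting L g V) (hk : (2 : k) ≠ 0) :
    Equivalent (ofCocycle (S.cocycle hk)) L := (S.retraction hk).equivalent

end Splitting
end LieTwoAlgebra

/-! ### Existence of splittings -/

namespace LieTwoAlgebra

open LieModule.Cohomology LieCohomology

section Existence

variable {k : Type u} [Field k] (L : LieTwoAlgebra.{u, v} k)

/-- The objects isomorphic to `0`. -/
def nullObjects : Submodule k L.Ob := (LinearMap.ker L.s).map L.t

/-- The automorphisms of `0`. -/
def zeroAut : Submodule k L.Mor := LinearMap.ker L.s ⊓ LinearMap.ker L.t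

theorem t_sub_s_mem (f : L.Mor) : L.t f - L.s f ∈ L.nullObjects :=
  ⟨f - L.i (L.s f), by simp, by simp⟩

theorem br_mem_right (x : L.Ob) {y : L.Ob} (hy : y ∈ L.nullObjects) : L.br x y ∈ L.nullObjects := by
  obtain ⟨f, hf, rfl⟩ := hy
  refine ⟨L.act x f, ?_, L.t_act x f⟩
  have hf' : L.s f = 0 := hf
  change L.s _ = 0
  rw [s_act, hf']
  exact map_zero _

theorem br_mem_left {x : L.Ob} (y : L.Ob) (hx : x ∈ L.nullObjects) : L.br x y ∈ L.nullObjects := by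
  rw [PreLieTwoAlgebra.br, L.bracket_skew.obj]
  exact neg_mem (L.br_mem_right y hx)

theorem act_mem_zeroAut (x : L.Ob) {f : L.Mor} (hf : f ∈ L.zeroAut) : L.act x f ∈ L.zeroAut := by
  have h1 : L.s f = 0 := hf.1
  have h2 : L.t f = 0 := hf.2
  refine ⟨?_, ?_⟩
  · change L.s _ = 0
    rw [s_act, h1]
    exact map_zero _
  · change L.t _ = 0
    rw [t_act, h2]
    exact map_zero _

/-- By `act_t_comm` the action of `t e` on `f` is, up to sign, that of `t f = 0` on `e`. Hence the
action on automorphisms of `0` descends to `Ob / D`. -/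
theorem act_nullObjects {x : L.Ob} (hx : x ∈ L.nullObjects) {f : L.Mor} (hf : f ∈ L.zeroAut) :
    L.act x f = 0 := by
  obtain ⟨e, he, rfl⟩ := hx
  rw [L.act_t_comm he hf.1, show L.t f = 0 from hf.2]
  simp

/-- The left side of `arrowJ_t` vanishes because `t f = 0`. -/
theorem act_act (x y : L.Ob) {f : L.Mor} (hf : f ∈ L.zeroAut) :
    L.act x (L.act y f) = L.act (L.br x y) f + L.act y (L.act x f) := by
  have h := L.arrowJ_t x y (f := f) hf.1
  have h2 : L.t f = 0 := hf.2
  rw [h2, arrowJ_eq, map_zero, PreLieTwoAlgebra.br, map_zero, map_zero] at h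
  linear_combination (norm := abel) -h

theorem exists_splitting (hk : (2 : k) ≠ 0) :
    ∃ (g V : Type v) (_ : LieRing g) (_ : LieAlgebra k g) (_ : AddCommGroup V) (_ : Module k V)
      (_ : LieRingModule g V) (_ : LieModule k g V), Nonempty (Splitting L g V) := by
  let D := L.nullObjects
  obtain ⟨σ, hσ⟩ := D.mkQ.exists_rightInverse_of_surjective D.range_mkQ
  let d : LinearMap.ker L.s →ₗ[k] D :=
    (L.t ∘ₗ (LinearMap.ker L.s).subtype).codRestrict D fun f => ⟨f, f.2, rfl⟩
  have hd : LinearMap.range d = ⊤ := by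
    rw [LinearMap.range_eq_top]
    rintro ⟨_, f, hf, rfl⟩
    exact ⟨⟨f, hf⟩, rfl⟩
  -- A linear choice, for each null object, of a morphism from `0` to it; applied to `x - σ (p x)`
  -- it gives the contraction `h`.
  obtain ⟨r, hr⟩ := d.exists_rightInverse_of_surjective hd
  have pσ : ∀ x, D.mkQ (σ x) = x := LinearMap.congr_fun hσ
  have mem : ∀ x, x - σ (D.mkQ x) ∈ D := fun x =>
    (Submodule.Quotient.eq D).1 (pσ (D.mkQ x)).symm
  have σp : ∀ x y, D.mkQ (L.br (σ (D.mkQ x)) y) = D.mkQ (L.br x y) := fun x y => by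
    have h := L.br_mem_left y (mem x)
    rw [PreLieTwoAlgebra.br, map_sub, LinearMap.sub_apply] at h
    exact ((Submodule.Quotient.eq D).2 h).symm
  have σp' : ∀ x y, D.mkQ (L.br x (σ (D.mkQ y))) = D.mkQ (L.br x y) := fun x y => by
    have h := L.br_mem_right x (mem y)
    rw [PreLieTwoAlgebra.br, map_sub] at h
    exact ((Submodule.Quotient.eq D).2 h).symm
  let B : (L.Ob ⧸ D) →ₗ[k] (L.Ob ⧸ D) →ₗ[k] (L.Ob ⧸ D) :=
    (L.bracket.obj.compl₁₂ σ σ).compr₂ D.mkQ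
  have hB : ∀ x y, B x y = D.mkQ (L.br (σ x) (σ y)) := fun _ _ => rfl
  have skew : ∀ x y, B x y = -B y x := fun x y => by
    rw [hB, hB, PreLieTwoAlgebra.br, L.bracket_skew.obj, map_neg]
  have jac : ∀ x y z, B x (B y z) = B (B x y) z + B y (B x z) := fun x y z => by
    rw [skew y (B x z)]
    simp only [hB, σp, σp']
    -- The ends of any morphism agree in the quotient; for `J` this is the Jacobi identity.
    have h : D.mkQ (L.t (L.J (σ x) (σ y) (σ z))) = D.mkQ (L.s (L.J (σ x) (σ y) (σ z))) :=
      (Submodule.Quotient.eq D).2 (L.t_sub_s_mem _)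
    rw [L.t_J, L.s_J, map_add] at h
    linear_combination (norm := abel) h
  let iR : LieRing (L.Ob ⧸ D) :=
    { bracket := fun x y => B x y
      add_lie := fun x y z => by change B (x + y) z = B x z + B y z; simp
      lie_add := fun x y z => (B x).map_add y z
      lie_self := fun x => eq_zero_of_eq_neg hk (skew x x)
      leibniz_lie := jac }
  let iA : LieAlgebra k (L.Ob ⧸ D) := { lie_smul := fun c x y => (B x).map_smul c y }
  let A : (L.Ob ⧸ D) → L.zeroAut → L.zeroAut := fun x v =>
    ⟨L.act (σ x) v, L.act_mem_zeroAut _ v.2⟩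
  let iM : LieRingModule (L.Ob ⧸ D) L.zeroAut :=
    { bracket := A
      add_lie := fun x y v => Subtype.ext (by
        change L.act (σ (x + y)) v = L.act (σ x) v + L.act (σ y) v
        simp)
      lie_add := fun x v w => Subtype.ext ((L.act (σ x)).map_add v w)
      leibniz_lie := fun x y v => Subtype.ext (by
        change L.act (σ x) (L.act (σ y) v) = L.act (σ (B x y)) v + L.act (σ y) (L.act (σ x) v)
        have h := L.act_nullObjects (mem (L.br (σ x) (σ y))) v.2
        rw [map_sub, LinearMap.sub_apply, sub_eq_zero] at h
        rw [L.act_act _ _ v.2, h]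
        rfl) }
  let iLM : LieModule k (L.Ob ⧸ D) L.zeroAut :=
    { smul_lie := fun c x v => Subtype.ext (by
        change L.act (σ (c • x)) v = c • L.act (σ x) v
        simp)
      lie_smul := fun c x v => Subtype.ext ((L.act (σ x)).map_smul c v) }
  let h : L.Ob →ₗ[k] L.Mor := (LinearMap.ker L.s).subtype ∘ₗ r ∘ₗ
    (LinearMap.id - σ ∘ₗ D.mkQ).codRestrict D mem
  have h_apply : ∀ x, h x = r ⟨x - σ (D.mkQ x), mem x⟩ := fun _ => rfl
  have s_h : ∀ x, L.s (h x) = 0 := fun x => (r _).2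
  have t_h : ∀ x, L.t (h x) = x - σ (D.mkQ x) := fun x =>
    congrArg Subtype.val (LinearMap.congr_fun hr ⟨x - σ (D.mkQ x), mem x⟩)
  have p_t : ∀ f, D.mkQ (L.t f) = D.mkQ (L.s f) := fun f =>
    (Submodule.Quotient.eq D).2 (L.t_sub_s_mem f)
  refine ⟨L.Ob ⧸ D, L.zeroAut, iR, iA, inferInstance, inferInstance, iM, iLM, ⟨?_⟩⟩
  exact
    { p := D.mkQ
      σ := σ
      h := h
      ι := L.zeroAut.subtype
      q := (LinearMap.id - L.i ∘ₗ L.s - h ∘ₗ (L.t - L.s)).codRestrict L.zeroAut fun f => by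
        change f - L.i (L.s f) - h (L.t f - L.s f) ∈ L.zeroAut
        refine ⟨?_, ?_⟩
        · change L.s _ = 0
          simp only [map_sub, s_h, L.s_i]
          simp
        · change L.t _ = 0
          simp only [map_sub, t_h, L.t_i, p_t]
          simp
      p_σ := pσ
      p_t := p_t
      s_h := s_h
      t_h := t_h
      h_σ := fun x => by
        have e : (⟨σ x - σ (D.mkQ (σ x)), mem (σ x)⟩ : D) = 0 := Subtype.ext (by
          change σ x - σ (D.mkQ (σ x)) = 0
          rw [pσ, sub_self])
        rw [h_apply, e, map_zero]
        rfl
      ι_injective := Subtype.val_injective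
      s_ι := fun v => v.2.1
      t_ι := fun v => v.2.2
      ι_q := fun _ => rfl
      lie := fun _ _ => rfl
      ι_lie := fun _ _ => rfl }

end Existence

end LieTwoAlgebra

/-! ### The bijection on classes -/

theorem mainTheorem2 (k : Type u) [Field k] (hk : (2 : k) ≠ 0) :
    ∃ Φ : LieTwoAlgebraClass.{u, v} k ≃ LieQuadrupleClass.{u, v} k,
      ∀ (g V : Type v) [LieRing g] [LieAlgebra k g] [AddCommGroup V] [Module k V]
        [LieRingModule g V] [LieModule k g V] (ω : LieCohomology.threeCocycle k g V),
        Φ (LieTwoAlgebra.ofCocycle ω).toClass =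
          (LieQuadruple.mk g V (LieCohomology.H3.mk ω)).toClass := by
  have rep : ∀ Q : LieQuadruple.{u, v} k, ∃ ω : LieCohomology.threeCocycle k Q.g Q.V,
      LieCohomology.H3.mk ω = Q.cls := fun Q => Submodule.Quotient.mk_surjective _ Q.cls
  choose ω hω using rep
  have eta : ∀ Q, LieQuadruple.mk Q.g Q.V (LieCohomology.H3.mk (ω Q)) = Q := fun Q => by
    rw [hω]
  -- The inverse map is the one constructed, since it only needs a representing cocycle for each
  -- class and no choice of splittings.
  let Ψ : LieQuadrupleClass.{u, v} k → LieTwoAlgebraClass.{u, v} k :=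
    Quotient.lift (fun Q => (LieTwoAlgebra.ofCocycle (ω Q)).toClass) fun Q Q' h =>
      Quotient.sound (LieTwoAlgebra.equivalent_of_isomorphic (by rw [eta, eta]; exact h))
  have hΨ : ∀ (g V : Type v) [LieRing g] [LieAlgebra k g] [AddCommGroup V] [Module k V]
      [LieRingModule g V] [LieModule k g V] (η : LieCohomology.threeCocycle k g V),
      Ψ (LieQuadruple.mk g V (LieCohomology.H3.mk η)).toClass =
        (LieTwoAlgebra.ofCocycle η).toClass := fun g V _ _ _ _ _ _ η =>
    Quotient.sound (LieTwoAlgebra.equivalent_of_isomorphic (by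
      rw [eta]; exact LieQuadruple.isomorphic_equivalence.refl _))
  have inj : Function.Injective Ψ := by
    rintro ⟨Q⟩ ⟨Q'⟩ h
    have h' := LieTwoAlgebra.isomorphic_of_equivalent hk (Quotient.exact h)
    rw [eta, eta] at h'
    exact Quotient.sound h'
  have surj : Function.Surjective Ψ := by
    rintro ⟨L⟩
    obtain ⟨g, V, _, _, _, _, _, _, ⟨S⟩⟩ := LieTwoAlgebra.exists_splitting L hk
    exact ⟨_, (hΨ g V (S.cocycle hk)).trans (Quotient.sound (S.equivalent hk))⟩
  refine ⟨(Equiv.ofBijective Ψ ⟨inj, surj⟩).symm, fun g V _ _ _ _ _ _ η => ?_⟩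
  rw [Equiv.symm_apply_eq]
  exact (hΨ g V η).symm
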